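/- Let $M$ be a closed (compact, without boundary, not necessarily connected) oriented smooth three-manifold and let $X$ be a smooth vector field on $M$ without zeros. A \emph{partial section} of $X$ is a smooth immersion $\iota:\Sigma\to M$ of a compact surface $\Sigma$ with nonempty boundary whose restriction to the interior of $\Sigma$ is an embedding transverse to $X$, and which maps the tangent line of $\partial\Sigma$ at each boundary point $z$ onto the line spanned by $X(\iota(z))$. Orient $\Sigma$ by the unique orientation for which $X$ is positively transverse to $\iota$ on the interior of $\Sigma$, and give $\partial\Sigma$ the boundary orientation. The partial section is \emph{positive} if $\iota$ maps the orientation of every component of $\partial\Sigma$ to the direction of $X$, \emph{negative} if it maps the orientation of every component of $\partial\Sigma$ to the direction of $-X$, and \emph{signed} if it is positive or negative. A \emph{global cross-section} of $X$ is a closed surface smoothly embedded in $M$ that is transverse to $X$ and intersects every orbit of $X$. If $X$ admits a signed partial section, then $X$ admits no global cross-section. -/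

import Mathlib

open Topology
open scoped Manifold ContDiff

universe u v w

namespace PartialSections

/-- The ordered family `f` is a positively oriented basis of `V` for the orientation `o`. -/
def IsPositiveFrame {V : Type*} [AddCommGroup V] [Module ℝ V] {n : ℕ}
    (o : Orientation ℝ V (Fin n)) (f : Fin n → V) : Prop :=
  ∃ b : Module.Basis (Fin n) ℝ V, ⇑b = f ∧ b.orientation = o

/-- An orientation of an `n`-dimensional smooth manifold (possibly with boundary): an orientation
of each tangent space which is locally constant in the local trivializations of the tangent bundle
given by the charts. -/
structure ManifoldOrientation {n : ℕ} {H : Type*} [TopologicalSpace H]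
    (I : ModelWithCorners ℝ (EuclideanSpace ℝ (Fin n)) H)
    (M : Type*) [TopologicalSpace M] [ChartedSpace H M] [IsManifold I ∞ M] where
  /-- The orientation of the tangent space at a point. -/
  at' : ∀ x : M, Orientation ℝ (TangentSpace I x) (Fin n)
  /-- Near `x₀`, the differential of the chart at `x₀` carries the orientation at `x` to the
  orientation at `x₀`. -/
  locallyConstant : ∀ x₀ : M, ∀ᶠ x in 𝓝 x₀,
    ∀ hx : x ∈ (trivializationAt (EuclideanSpace ℝ (Fin n)) (TangentSpace I) x₀).baseSet,
      Orientation.map (Fin n)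
        ((trivializationAt (EuclideanSpace ℝ (Fin n)) (TangentSpace I) x₀).continuousLinearEquivAt
          ℝ x hx).toLinearEquiv (at' x) = at' x₀

section Surface

variable {S : Type*} [TopologicalSpace S] [ChartedSpace (EuclideanHalfSpace 2) S]

/-- The component of a tangent vector of a surface with boundary along the inward coordinate of
the preferred chart at its base point (a chart into the half-plane `{x | 0 ≤ x 0}`).
At a boundary point, a tangent vector is tangent to the boundary, outward pointing, or inward
pointing according to whether this number is zero, negative or positive. -/
def inwardCoord {z : S} (a : TangentSpace (𝓡∂ 2) z) : ℝ :=
  (show EuclideanSpace ℝ (Fin 2) from a) 0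

end Surface

section Sections

variable {M : Type u} [TopologicalSpace M] [ChartedSpace (EuclideanSpace ℝ (Fin 3)) M]
  (X : ∀ x : M, TangentSpace (𝓡 3) x)

section Partial

variable {S : Type v} [TopologicalSpace S] [ChartedSpace (EuclideanHalfSpace 2) S]

/-- The map `ι : S → M`, defined on a surface with nonempty boundary, is a partial section of `X`:
it is an immersion, it is an embedding transverse to `X` on the interior of `S`, and its boundary
is tangent to `X`. As `X` vanishes nowhere and `ι` is an immersion, the last condition says that
`ι` maps the tangent line of `∂S` at each boundary point `z` onto the line spanned by `X` at
`ι z`. -/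
structure IsPartialSection (ι : S → M) : Prop where
  boundary_nonempty : ((𝓡∂ 2).boundary S).Nonempty
  immersion : Manifold.IsImmersion (𝓡∂ 2) (𝓡 3) ∞ ι
  embedded_interior : IsEmbedding (fun p : (𝓡∂ 2).interior S => ι p)
  transverse_interior : ∀ p ∈ (𝓡∂ 2).interior S,
    X (ι p) ∉ Set.range (mfderiv (𝓡∂ 2) (𝓡 3) ι p)
  tangent_boundary : ∀ z ∈ (𝓡∂ 2).boundary S,
    ∃ a : TangentSpace (𝓡∂ 2) z, inwardCoord a = 0 ∧ mfderiv (𝓡∂ 2) (𝓡 3) ι z a = X (ι z)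

variable [IsManifold (𝓡 3) ∞ M] [IsManifold (𝓡∂ 2) ∞ S]

/-- With respect to the orientations `oM` of `M` and `oS` of `S`, the vector field `X` is
positively transverse to the interior of `ι : S → M`. -/
def IsPositivelyTransverse (oM : ManifoldOrientation (𝓡 3) M)
    (oS : ManifoldOrientation (𝓡∂ 2) S) (ι : S → M) : Prop :=
  ∀ p ∈ (𝓡∂ 2).interior S, ∀ a b : TangentSpace (𝓡∂ 2) p,
    IsPositiveFrame (oS.at' p) ![a, b] →
      IsPositiveFrame (oM.at' (ι p))
        ![X (ι p), mfderiv (𝓡∂ 2) (𝓡 3) ι p a, mfderiv (𝓡∂ 2) (𝓡 3) ι p b]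

/-- A positive partial section: when `S` carries the orientation for which `X` is positively
transverse to its interior, the boundary orientation (outward vector first) of `∂S` is everywhere
the direction of `X`. -/
def IsPositivePartialSection (oM : ManifoldOrientation (𝓡 3) M) (ι : S → M) : Prop :=
  IsPartialSection X ι ∧ ∃ oS : ManifoldOrientation (𝓡∂ 2) S,
    IsPositivelyTransverse X oM oS ι ∧
    ∀ z ∈ (𝓡∂ 2).boundary S, ∀ ν a : TangentSpace (𝓡∂ 2) z,
      inwardCoord ν < 0 → inwardCoord a = 0 → mfderiv (𝓡∂ 2) (𝓡 3) ι z a = X (ι z) →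
        IsPositiveFrame (oS.at' z) ![ν, a]

/-- A negative partial section: when `S` carries the orientation for which `X` is positively
transverse to its interior, the boundary orientation (outward vector first) of `∂S` is everywhere
opposite to the direction of `X`. -/
def IsNegativePartialSection (oM : ManifoldOrientation (𝓡 3) M) (ι : S → M) : Prop :=
  IsPartialSection X ι ∧ ∃ oS : ManifoldOrientation (𝓡∂ 2) S,
    IsPositivelyTransverse X oM oS ι ∧
    ∀ z ∈ (𝓡∂ 2).boundary S, ∀ ν a : TangentSpace (𝓡∂ 2) z,
      inwardCoord ν < 0 → inwardCoord a = 0 → mfderiv (𝓡∂ 2) (𝓡 3) ι z a = X (ι z) →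
        IsPositiveFrame (oS.at' z) ![ν, -a]

end Partial

/-- The vector field `X` on `M`, oriented by `oM`, admits a partial section, defined on a compact
smooth surface with boundary, that is positive or negative. -/
def AdmitsSignedPartialSection [IsManifold (𝓡 3) ∞ M] (oM : ManifoldOrientation (𝓡 3) M) : Prop :=
  ∃ (S : Type v) (_ : TopologicalSpace S) (_ : ChartedSpace (EuclideanHalfSpace 2) S)
    (_ : IsManifold (𝓡∂ 2) ∞ S),
    T2Space S ∧ CompactSpace S ∧
      ∃ ι : S → M, IsPositivePartialSection X oM ι ∨ IsNegativePartialSection X oM ι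

/-- The map `j : S → M`, defined on a surface without boundary, is a smooth embedding transverse
to `X` whose image meets every orbit of `X`. -/
structure IsGlobalCrossSection {S : Type w} [TopologicalSpace S]
    [ChartedSpace (EuclideanSpace ℝ (Fin 2)) S] (j : S → M) : Prop where
  embedding : Manifold.IsSmoothEmbedding (𝓡 2) (𝓡 3) ∞ j
  transverse : ∀ p : S, X (j p) ∉ Set.range (mfderiv (𝓡 2) (𝓡 3) j p)
  meets_orbits : ∀ γ : ℝ → M, IsMIntegralCurve γ X → ∃ t : ℝ, γ t ∈ Set.range j

/-- The vector field `X` admits a global cross-section: a closed embedded surface transverse to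
`X` that meets every orbit. -/
def AdmitsGlobalCrossSection : Prop :=
  ∃ (S : Type w) (_ : TopologicalSpace S) (_ : ChartedSpace (EuclideanSpace ℝ (Fin 2)) S)
    (_ : IsManifold (𝓡 2) ∞ S), T2Space S ∧ CompactSpace S ∧
      ∃ j : S → M, IsGlobalCrossSection X j

end Sections

end PartialSections

/-! A global cross-section T is dual to a closed one-form on M. Take a smooth function b that
vanishes on T, vanishes nowhere else near T, and increases along X there. Let a be a bump function
of b, cut off to a neighbourhood of T. Then a is locally a function of b, so `a db` is closed;
moreover a ≥ 0, a > 0 on T, and X b > 0 wherever a ≠ 0 (`exists_dual_form`).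

Pulled back to the surface Σ of a partial section, this form stays closed, so by Stokes its integral
over ∂Σ is zero. If the section is signed, ∂Σ runs everywhere along X or everywhere against X, so
the integrand has constant sign and must vanish identically (`boundary_form_eq_zero`). Hence a = 0
on the image of ∂Σ.

On the other hand, the image of ∂Σ is nonempty, compact and tangent to X, hence invariant under the
flow (`isMIntegralCurve_mem_image_boundary`). Since M is compact, integral curves exist for all time
(`exists_isMIntegralCurve`), so an orbit inside this image meets T
(`IsPartialSection.exists_boundary_mem_range`), where a > 0. This is the contradiction in
`IsPartialSection.not_isGlobalCrossSection`, which treats both signs together through a nonzero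
factor s.

Stokes is proved without defining an integral over Σ. In a chart, the two-form df ∧ dg is the
Jacobian determinant `jac`, and the half-plane case is the divergence theorem. For a partition of
unity ρ, the numbers ∫ ρ_j A dρ_i ∧ dB can be computed in chart i or in chart j. Summing over j in
chart i gives ∫ d(ρ_i A) ∧ dB, because dA ∧ dB = 0; summing over i in chart j gives 0, because ∑ ρ_i
= 1. Exchanging the two sums shows that the boundary terms add up to zero. -/

namespace PartialSections

open MeasureTheory Set

/-! ### Calculus and Stokes' theorem in the half-plane. -/

/-- The Euclidean plane. -/
abbrev Plane := EuclideanSpace ℝ (Fin 2)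

/-- The closed half-plane `{y | 0 ≤ y 0}`, as the range of the model with corners. -/
abbrev halfPlane : Set Plane := range (𝓡∂ 2)

lemma mem_halfPlane {y : Plane} : y ∈ halfPlane ↔ 0 ≤ y 0 := by
  rw [halfPlane, range_modelWithCornersEuclideanHalfSpace]; rfl

lemma uniqueDiffOn_halfPlane : UniqueDiffOn ℝ halfPlane := (𝓡∂ 2).uniqueDiffOn

lemma isOpen_zero_lt : IsOpen {y : Plane | 0 < y 0} :=
  isOpen_lt continuous_const (by fun_prop)

lemma halfPlane_mem_nhds {y : Plane} (hy : 0 < y 0) : halfPlane ∈ 𝓝 y :=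
  Filter.mem_of_superset (isOpen_zero_lt.mem_nhds hy) fun _ hz => mem_halfPlane.2 (le_of_lt hz)

/-- The partial derivative, within the closed half-plane, in the direction of the `k`-th
coordinate. -/
noncomputable def partialWithin (k : Fin 2) (f : Plane → ℝ) (y : Plane) : ℝ :=
  fderivWithin ℝ f halfPlane y (EuclideanSpace.single k 1)

/-- The Jacobian determinant of a pair of functions on the half-plane. -/
noncomputable def jac (f g : Plane → ℝ) (y : Plane) : ℝ :=
  partialWithin 0 f y * partialWithin 1 g y - partialWithin 1 f y * partialWithin 0 g y

lemma contDiffOn_partialWithin {V : Set Plane} (hV : IsOpen V) {f : Plane → ℝ}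
    (hf : ContDiffOn ℝ ∞ f (halfPlane ∩ V)) (k : Fin 2) :
    ContDiffOn ℝ ∞ (partialWithin k f) (halfPlane ∩ V) := by
  have h1 := hf.fderivWithin (m := ∞) (uniqueDiffOn_halfPlane.inter hV) (by simp)
  have h2 : ContDiffOn ℝ ∞ (fun y => fderivWithin ℝ f (halfPlane ∩ V) y
      (EuclideanSpace.single k 1)) (halfPlane ∩ V) := h1.clm_apply contDiffOn_const
  refine h2.congr fun y hy => ?_
  rw [partialWithin, fderivWithin_inter (hV.mem_nhds hy.2)]

lemma partialWithin_congr {f g : Plane → ℝ} {y : Plane} (hy : y ∈ halfPlane)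
    (h : f =ᶠ[𝓝[halfPlane] y] g) (k : Fin 2) : partialWithin k f y = partialWithin k g y := by
  rw [partialWithin, partialWithin, h.fderivWithin_eq_of_mem hy]

lemma partialWithin_const (k : Fin 2) (c : ℝ) (y : Plane) :
    partialWithin k (fun _ => c) y = 0 := by
  simp [partialWithin]

lemma partialWithin_mul {f g : Plane → ℝ} {y : Plane} (hy : y ∈ halfPlane)
    (hf : DifferentiableWithinAt ℝ f halfPlane y) (hg : DifferentiableWithinAt ℝ g halfPlane y)
    (k : Fin 2) : partialWithin k (fun x => f x * g x) y
      = f y * partialWithin k g y + partialWithin k f y * g y := by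
  rw [partialWithin, fderivWithin_fun_mul (uniqueDiffOn_halfPlane y hy) hf hg]
  simp [partialWithin]; ring

lemma partialWithin_neg {f : Plane → ℝ} {y : Plane} (hy : y ∈ halfPlane) (k : Fin 2) :
    partialWithin k (fun x => - f x) y = - partialWithin k f y := by
  rw [partialWithin, fderivWithin_fun_neg (uniqueDiffOn_halfPlane y hy)]
  simp [partialWithin]

/-- Second partial derivatives commute. -/
lemma partialWithin_comm {V : Set Plane} (hV : IsOpen V) {f : Plane → ℝ}
    (hf : ContDiffOn ℝ ∞ f (halfPlane ∩ V)) {y : Plane} (hy : 0 < y 0) (hyV : y ∈ V) :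
    partialWithin 0 (partialWithin 1 f) y = partialWithin 1 (partialWithin 0 f) y := by
  have hn : halfPlane ∈ 𝓝 y := halfPlane_mem_nhds hy
  have hfy : ContDiffWithinAt ℝ ∞ f halfPlane y := by
    have := hf y ⟨mem_halfPlane.2 hy.le, hyV⟩
    rwa [contDiffWithinAt_inter (hV.mem_nhds hyV)] at this
  have hsym := hfy.isSymmSndFDerivWithinAt (by simp; norm_cast) uniqueDiffOn_halfPlane
    (subset_closure (mem_interior_iff_mem_nhds.2 hn)) (mem_halfPlane.2 hy.le)
  have hd : DifferentiableWithinAt ℝ (fderivWithin ℝ f halfPlane) halfPlane y :=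
    (hfy.fderivWithin_right (m := 1) uniqueDiffOn_halfPlane (by norm_cast)
      (mem_halfPlane.2 hy.le)).differentiableWithinAt (by simp)
  have key : ∀ k l : Fin 2, partialWithin k (partialWithin l f) y =
      fderivWithin ℝ (fderivWithin ℝ f halfPlane) halfPlane y (EuclideanSpace.single k 1)
        (EuclideanSpace.single l 1) := by
    intro k l
    have h2 : partialWithin l f = fun x => fderivWithin ℝ f halfPlane x
      (EuclideanSpace.single l 1) := rfl
    rw [partialWithin, h2, fderivWithin_clm_apply (uniqueDiffOn_halfPlane y
      (mem_halfPlane.2 hy.le)) hd (differentiableWithinAt_const _)]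
    simp
  rw [key, key]
  exact hsym.eq _ _

/-- The coordinates of the plane. -/
noncomputable def planeEquiv : (ℝ × ℝ) ≃L[ℝ] Plane :=
  (ContinuousLinearEquiv.finTwoArrow ℝ ℝ).symm.trans (EuclideanSpace.equiv (Fin 2) ℝ).symm

lemma planeEquiv_apply (p : ℝ × ℝ) : planeEquiv p = !₂[p.1, p.2] := rfl

@[simp] lemma planeEquiv_zero (p : ℝ × ℝ) : planeEquiv p 0 = p.1 := rfl

@[simp] lemma planeEquiv_one (p : ℝ × ℝ) : planeEquiv p 1 = p.2 := rfl

lemma planeEquiv_fst : planeEquiv (1, 0) = EuclideanSpace.single 0 1 := by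
  ext i; fin_cases i <;> simp [planeEquiv_apply]

lemma planeEquiv_snd : planeEquiv (0, 1) = EuclideanSpace.single 1 1 := by
  ext i; fin_cases i <;> simp [planeEquiv_apply]

lemma measurePreserving_planeEquiv : MeasurePreserving planeEquiv volume volume :=
  (PiLp.volume_preserving_toLp (Fin 2)).comp ((volume_preserving_finTwoArrow ℝ).symm _)

lemma setIntegral_planeEquiv (s : Set Plane) (f : Plane → ℝ) :
    ∫ y in s, f y = ∫ p in planeEquiv ⁻¹' s, f (planeEquiv p) :=
  (measurePreserving_planeEquiv.setIntegral_preimage_emb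
    planeEquiv.toHomeomorph.measurableEmbedding f s).symm

/-- The divergence theorem in the closed half-plane. -/
lemma integral_divergence_halfPlane {F G : Plane → ℝ} (hF : ContDiffOn ℝ ∞ F halfPlane)
    (hG : ContDiffOn ℝ ∞ G halfPlane) {K : Set Plane} (hK : IsCompact K)
    (hF0 : ∀ y ∈ halfPlane, y ∉ K → F y = 0) (hG0 : ∀ y ∈ halfPlane, y ∉ K → G y = 0) :
    ∫ y in {y : Plane | 0 < y 0}, (partialWithin 0 F y + partialWithin 1 G y)
      = - ∫ t : ℝ, F !₂[0, t] := by
  -- K lies strictly inside the box of size R, so of the four faces of [0, R] × [-R, R] only the one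
  -- on the boundary line contributes.
  obtain ⟨R, hR0, hR⟩ : ∃ R : ℝ, 0 < R ∧ ∀ y ∈ K, ∀ i, |y i| < R := by
    obtain ⟨R, hR⟩ := hK.isBounded.exists_norm_le
    refine ⟨max R 0 + 1, by positivity, fun y hy i => ?_⟩
    have h1 := EuclideanSpace.norm_sq_eq y
    have h2 : ‖y i‖ ≤ ‖y‖ := PiLp.norm_apply_le y i
    rw [Real.norm_eq_abs] at h2
    have := hR y hy
    have := le_max_left R 0
    linarith
  have hcont : ContinuousOn (fun y => partialWithin 0 F y + partialWithin 1 G y) halfPlane := by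
    have h1 := contDiffOn_partialWithin isOpen_univ (by simpa using hF) 0
    have h2 := contDiffOn_partialWithin isOpen_univ (by simpa using hG) 1
    simp only [inter_univ] at h1 h2
    exact h1.continuousOn.add h2.continuousOn
  have hbox : ∀ p ∈ Icc ((0 : ℝ), -R) (R, R), planeEquiv p ∈ halfPlane := by
    intro p hp
    exact mem_halfPlane.2 hp.1.1
  have hder : ∀ {f : Plane → ℝ}, ContDiffOn ℝ ∞ f halfPlane →
      ∀ p ∈ Ioo (0 : ℝ) R ×ˢ Ioo (-R) R, HasFDerivAt (fun p => f (planeEquiv p))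
        ((fderivWithin ℝ f halfPlane (planeEquiv p)).comp
          (planeEquiv : ℝ × ℝ →L[ℝ] Plane)) p := by
    intro f hf p hp
    have hpos : 0 < planeEquiv p 0 := hp.1.1
    have h1 : HasFDerivAt f (fderivWithin ℝ f halfPlane (planeEquiv p)) (planeEquiv p) :=
      ((hf.differentiableOn (by simp) _ (mem_halfPlane.2 hpos.le)).hasFDerivWithinAt).hasFDerivAt
        (halfPlane_mem_nhds hpos)
    exact h1.comp p planeEquiv.hasFDerivAt
  have main := integral_divergence_prod_Icc_of_hasFDerivAt_of_le (fun p => F (planeEquiv p))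
    (fun p => G (planeEquiv p))
    (fun p => (fderivWithin ℝ F halfPlane (planeEquiv p)).comp (planeEquiv : ℝ × ℝ →L[ℝ] Plane))
    (fun p => (fderivWithin ℝ G halfPlane (planeEquiv p)).comp (planeEquiv : ℝ × ℝ →L[ℝ] Plane))
    (0, -R) (R, R) ⟨hR0.le, by simp; linarith⟩
    (hF.continuousOn.comp planeEquiv.continuous.continuousOn hbox)
    (hG.continuousOn.comp planeEquiv.continuous.continuousOn hbox)
    (hder hF) (hder hG)
    (by
      refine ContinuousOn.integrableOn_compact isCompact_Icc ?_
      refine (hcont.comp planeEquiv.continuous.continuousOn hbox).congr fun p _ => ?_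
      simp [partialWithin, planeEquiv_fst, planeEquiv_snd])
  simp only [ContinuousLinearMap.comp_apply, ContinuousLinearEquiv.coe_coe, planeEquiv_fst,
    planeEquiv_snd] at main
  have hGv : ∀ x ∈ Icc (0 : ℝ) R, ∀ t : ℝ, R ≤ |t| → G (planeEquiv (x, t)) = 0 := by
    intro x hx t ht
    refine hG0 _ (mem_halfPlane.2 hx.1) fun h => ?_
    have := hR _ h 1
    simp at this; linarith
  have hg1 : ∫ x in (0 : ℝ)..R, G (planeEquiv (x, R)) = 0 := by
    rw [intervalIntegral.integral_congr (g := fun _ => (0 : ℝ))]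
    · simp
    · intro x hx
      rw [uIcc_of_le hR0.le] at hx
      exact hGv x hx R (le_abs_self R)
  have hg2 : ∫ x in (0 : ℝ)..R, G (planeEquiv (x, -R)) = 0 := by
    rw [intervalIntegral.integral_congr (g := fun _ => (0 : ℝ))]
    · simp
    · intro x hx
      rw [uIcc_of_le hR0.le] at hx
      exact hGv x hx (-R) (by rw [abs_neg]; exact le_abs_self R)
  have hf1 : ∫ y in (-R)..R, F (planeEquiv (R, y)) = 0 := by
    rw [intervalIntegral.integral_congr (g := fun _ => (0 : ℝ))]
    · simp
    · intro y _
      refine hF0 _ (mem_halfPlane.2 hR0.le) fun h => ?_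
      have := hR _ h 0
      simp [abs_of_pos hR0] at this
  have hf2 : ∫ y in (-R)..R, F (planeEquiv (0, y)) = ∫ t : ℝ, F !₂[0, t] := by
    rw [intervalIntegral.integral_eq_integral_of_support_subset]
    · rfl
    · intro t ht
      by_contra hcon
      refine ht (hF0 _ (mem_halfPlane.2 le_rfl) fun h => hcon ?_)
      have := hR _ h 1
      simp only [planeEquiv_one] at this
      exact ⟨(abs_lt.1 this).1, (abs_lt.1 this).2.le⟩
  rw [hg1, hg2, hf1, hf2] at main
  simp only [sub_self, zero_add, zero_sub] at main
  rw [← main, setIntegral_planeEquiv]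
  have hae : (Icc ((0 : ℝ), -R) (R, R) : Set (ℝ × ℝ)) =ᵐ[volume] Ioo (0 : ℝ) R ×ˢ Ioo (-R) R := by
    rw [Icc_prod_eq]
    exact (Measure.set_prod_ae_eq Ioo_ae_eq_Icc Ioo_ae_eq_Icc).symm
  rw [setIntegral_congr_set hae]
  -- Outside the box, F and G vanish near each point of the half-plane, so the divergence vanishes
  -- there too.
  refine setIntegral_eq_of_subset_of_forall_sdiff_eq_zero ?_ ?_ ?_
  · exact (isOpen_zero_lt.preimage planeEquiv.continuous).measurableSet
  · intro p hp
    exact hp.1.1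
  · rintro p ⟨hp, hp2⟩
    have hpK : planeEquiv p ∉ K := by
      intro h
      refine hp2 ⟨⟨hp, ?_⟩, ?_⟩
      · have := hR _ h 0
        exact (abs_lt.1 this).2
      · exact abs_lt.1 (hR _ h 1)
    have hev : ∀ {f : Plane → ℝ}, (∀ y ∈ halfPlane, y ∉ K → f y = 0) →
        f =ᶠ[𝓝[halfPlane] (planeEquiv p)] fun _ => 0 := by
      intro f hf
      filter_upwards [self_mem_nhdsWithin,
        mem_nhdsWithin_of_mem_nhds (hK.isClosed.isOpen_compl.mem_nhds hpK)] with y h1 h2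
      exact hf y h1 h2
    have hpH : planeEquiv p ∈ halfPlane := mem_halfPlane.2 (le_of_lt hp)
    rw [partialWithin_congr hpH (hev hF0), partialWithin_congr hpH (hev hG0),
      partialWithin_const, partialWithin_const, add_zero]

/-- K is closed and contained in V, so near a point outside V the extension by zero is identically
zero. This turns chart-local data into functions to which the divergence theorem on the whole
half-plane applies. -/
lemma contDiffOn_indicator_of_compact {V K : Set Plane} (hV : IsOpen V) (hK : IsCompact K)
    (hKV : K ⊆ V) {f : Plane → ℝ} (hf : ContDiffOn ℝ ∞ f (halfPlane ∩ V))
    (hf0 : ∀ y ∈ halfPlane ∩ V, y ∉ K → f y = 0) :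
    ContDiffOn ℝ ∞ (V.indicator f) halfPlane := by
  intro y hy
  by_cases hyV : y ∈ V
  · have := hf y ⟨hy, hyV⟩
    rw [contDiffWithinAt_inter (hV.mem_nhds hyV)] at this
    refine this.congr_of_eventuallyEq ?_ (indicator_of_mem hyV f)
    filter_upwards [mem_nhdsWithin_of_mem_nhds (hV.mem_nhds hyV)] with z hz
    exact indicator_of_mem hz f
  · have hyK : y ∉ K := fun h => hyV (hKV h)
    refine (contDiffWithinAt_const (c := (0 : ℝ))).congr_of_eventuallyEq ?_
      (indicator_of_notMem hyV f)
    filter_upwards [self_mem_nhdsWithin,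
      mem_nhdsWithin_of_mem_nhds (hK.isClosed.isOpen_compl.mem_nhds hyK)] with z hz hzK
    by_cases hzV : z ∈ V
    · rw [indicator_of_mem hzV, hf0 z ⟨hz, hzV⟩ hzK]
    · rw [indicator_of_notMem hzV]

lemma partialWithin_indicator {V : Set Plane} (hV : IsOpen V) (f : Plane → ℝ) {y : Plane}
    (hy : y ∈ halfPlane) (hyV : y ∈ V) (k : Fin 2) :
    partialWithin k (V.indicator f) y = partialWithin k f y := by
  refine partialWithin_congr hy ?_ k
  filter_upwards [mem_nhdsWithin_of_mem_nhds (hV.mem_nhds hyV)] with z hz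
  exact indicator_of_mem hz f

/-- Stokes' theorem for the one-form `u dv` in the closed half-plane. -/
lemma integral_jac_halfPlane {V K : Set Plane} (hV : IsOpen V) (hK : IsCompact K)
    (hKV : K ⊆ V) {u v : Plane → ℝ} (hu : ContDiffOn ℝ ∞ u (halfPlane ∩ V))
    (hv : ContDiffOn ℝ ∞ v (halfPlane ∩ V)) (hu0 : ∀ y ∈ halfPlane ∩ V, y ∉ K → u y = 0) :
    ∫ y in V ∩ {y : Plane | 0 < y 0}, jac u v y
      = - ∫ t : ℝ, V.indicator (fun y => u y * partialWithin 1 v y) !₂[0, t] := by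
  -- The vector field is (u ∂₁v, -u ∂₀v); its divergence is the Jacobian of (u, v), because the
  -- mixed second derivatives of v cancel.
  have h1 := contDiffOn_indicator_of_compact hV hK hKV
    (hu.mul (contDiffOn_partialWithin hV hv 1)) (fun y hy hyK => by simp [hu0 y hy hyK])
  have h0 := contDiffOn_indicator_of_compact hV hK hKV
    (hu.mul (contDiffOn_partialWithin hV hv 0)).neg (fun y hy hyK => by simp [hu0 y hy hyK])
  have hz : ∀ {f : Plane → ℝ}, (∀ y ∈ halfPlane ∩ V, y ∉ K → f y = 0) →
      ∀ y ∈ halfPlane, y ∉ K → V.indicator f y = 0 := by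
    intro f hf y hy hyK
    by_cases hyV : y ∈ V
    · rw [indicator_of_mem hyV, hf y ⟨hy, hyV⟩ hyK]
    · rw [indicator_of_notMem hyV]
  have main := integral_divergence_halfPlane h1 h0 hK
    (hz fun y hy hyK => by simp [hu0 y hy hyK]) (hz fun y hy hyK => by simp [hu0 y hy hyK])
  rw [← main, inter_comm, ← setIntegral_indicator hV.measurableSet]
  refine setIntegral_congr_fun isOpen_zero_lt.measurableSet fun y hy => ?_
  have hyH : y ∈ halfPlane := mem_halfPlane.2 (le_of_lt hy)
  by_cases hyV : y ∈ V
  · have hdu : ∀ {f : Plane → ℝ}, ContDiffOn ℝ ∞ f (halfPlane ∩ V) →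
        DifferentiableWithinAt ℝ f halfPlane y := by
      intro f hf
      have := hf.differentiableOn (by simp) y ⟨hyH, hyV⟩
      rwa [differentiableWithinAt_inter (hV.mem_nhds hyV)] at this
    rw [indicator_of_mem hyV, partialWithin_indicator hV _ hyH hyV,
      partialWithin_indicator hV _ hyH hyV, partialWithin_neg hyH,
      partialWithin_mul hyH (hdu hu) (hdu (contDiffOn_partialWithin hV hv 1)),
      partialWithin_mul hyH (hdu hu) (hdu (contDiffOn_partialWithin hV hv 0)),
      partialWithin_comm hV hv hy hyV, jac]
    ring
  · have hyK : y ∉ K := fun h => hyV (hKV h)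
    have hev : ∀ {f : Plane → ℝ}, (∀ y ∈ halfPlane ∩ V, y ∉ K → f y = 0) →
        V.indicator f =ᶠ[𝓝[halfPlane] y] fun _ => 0 := by
      intro f hf
      filter_upwards [self_mem_nhdsWithin,
        mem_nhdsWithin_of_mem_nhds (hK.isClosed.isOpen_compl.mem_nhds hyK)] with z h1 h2
      exact hz hf z h1 h2
    rw [indicator_of_notMem hyV,
      partialWithin_congr hyH (hev fun y hy hyK => by simp [hu0 y hy hyK]),
      partialWithin_congr hyH (hev fun y hy hyK => by simp [hu0 y hy hyK]),
      partialWithin_const, partialWithin_const, add_zero]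

/-! ### Orientations and determinants in the plane. -/

section OrientationSign

/-- The standard basis of the plane. -/
noncomputable def planeBasis : Module.Basis (Fin 2) ℝ Plane :=
  (EuclideanSpace.basisFun (Fin 2) ℝ).toBasis

@[simp] lemma planeBasis_apply (i : Fin 2) : planeBasis i = EuclideanSpace.single i 1 := by
  simp [planeBasis]

open Classical in
/-- The sign of an orientation of the plane, compared to the standard one. -/
noncomputable def orientationSign (o : Orientation ℝ Plane (Fin 2)) : ℝ :=
  if o = planeBasis.orientation then 1 else -1

lemma neg_orientation_ne : -planeBasis.orientation ≠ planeBasis.orientation :=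
  (Module.Ray.ne_neg_self _).symm

lemma orientationSign_basis : orientationSign planeBasis.orientation = 1 := if_pos rfl

lemma orientationSign_neg_basis : orientationSign (-planeBasis.orientation) = -1 :=
  if_neg neg_orientation_ne

/-- A linear map preserves or reverses the standard orientation according to the sign of its
determinant. The identity is shaped for the change of variables formula, which produces the absolute
value of the determinant, whereas pulling back a two-form produces the determinant itself. -/
lemma orientationSign_mul_det {o o' : Orientation ℝ Plane (Fin 2)} (L : Plane ≃ₗ[ℝ] Plane)
    (h : Orientation.map (Fin 2) L o = o') :
    orientationSign o * LinearMap.det (L : Plane →ₗ[ℝ] Plane)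
      = orientationSign o' * |LinearMap.det (L : Plane →ₗ[ℝ] Plane)| := by
  rw [planeBasis.map_orientation_eq_det_inv_smul] at h
  have hu : ((LinearEquiv.det L : ℝˣ) : ℝ) = LinearMap.det (L : Plane →ₗ[ℝ] Plane) :=
    LinearEquiv.coe_det L
  rw [← hu]
  rcases lt_or_gt_of_ne (LinearEquiv.det L).ne_zero with hneg | hpos
  · have hneg' : (((LinearEquiv.det L)⁻¹ : ℝˣ) : ℝ) < 0 := by
      rw [Units.val_inv_eq_inv_val]; exact inv_lt_zero.2 hneg
    rw [Module.Ray.units_smul_of_neg _ hneg'] at h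
    rw [abs_of_neg hneg, ← h]
    rcases planeBasis.orientation_eq_or_eq_neg o with rfl | rfl
    · rw [orientationSign_basis, orientationSign_neg_basis]; ring
    · have hnn : -(-planeBasis.orientation) = planeBasis.orientation := by
        exact neg_neg (G := Module.Ray ℝ (Plane [⋀^Fin 2]→ₗ[ℝ] ℝ)) _
      rw [hnn, orientationSign_basis, orientationSign_neg_basis]; ring
  · have hpos' : 0 < (((LinearEquiv.det L)⁻¹ : ℝˣ) : ℝ) := by
      rw [Units.val_inv_eq_inv_val]; exact inv_pos.2 hpos
    rw [Module.Ray.units_smul_of_pos _ hpos'] at h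
    rw [abs_of_pos hpos, ← h]

lemma det_plane (L : Plane →L[ℝ] Plane) : L.det =
    L (EuclideanSpace.single 0 1) 0 * L (EuclideanSpace.single 1 1) 1
      - L (EuclideanSpace.single 1 1) 0 * L (EuclideanSpace.single 0 1) 1 := by
  rw [ContinuousLinearMap.det, ← LinearMap.det_toMatrix planeBasis, Matrix.det_fin_two]
  simp [LinearMap.toMatrix_apply, planeBasis]

lemma plane_eq (v : Plane) :
    v = v 0 • EuclideanSpace.single 0 1 + v 1 • EuclideanSpace.single 1 1 := by
  ext i; fin_cases i <;> simp

/-- This is L*(α ∧ β) = det L · (α ∧ β), evaluated on the standard basis. -/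
lemma det_pullback (L : Plane →L[ℝ] Plane) (α β : Plane →L[ℝ] ℝ) :
    α (L (EuclideanSpace.single 0 1)) * β (L (EuclideanSpace.single 1 1))
      - α (L (EuclideanSpace.single 1 1)) * β (L (EuclideanSpace.single 0 1))
    = L.det * (α (EuclideanSpace.single 0 1) * β (EuclideanSpace.single 1 1)
      - α (EuclideanSpace.single 1 1) * β (EuclideanSpace.single 0 1)) := by
  rw [det_plane, plane_eq (L (EuclideanSpace.single 0 1)), plane_eq (L (EuclideanSpace.single 1 1))]
  simp only [map_add, map_smul, smul_eq_mul, PiLp.add_apply, PiLp.smul_apply, PiLp.single_apply]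
  simp
  ring

/-- The frame `(-e₀, -s e₁)`, where `s` is the sign of the orientation, is positive. -/
lemma isPositiveFrame_plane (o : Orientation ℝ Plane (Fin 2)) :
    IsPositiveFrame o ![-EuclideanSpace.single 0 1,
      (-orientationSign o) • EuclideanSpace.single 1 1] := by
  have hs : IsUnit (-1 : ℝ) ∧ IsUnit (-orientationSign o) := by
    constructor
    · simp
    · unfold orientationSign; split_ifs <;> simp
  refine ⟨planeBasis.isUnitSMul (w := ![-1, -orientationSign o]) (fun i => ?_), ?_, ?_⟩
  · fin_cases i
    · exact hs.1
    · exact hs.2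
  · ext i j
    fin_cases i <;> simp [Module.Basis.isUnitSMul_apply]
  · rcases planeBasis.orientation_eq_or_eq_neg o with rfl | rfl
    · rw [eq_comm, Module.Basis.orientation_eq_iff_det_pos, Module.Basis.det_isUnitSMul]
      simp [orientationSign_basis]
    · rw [← planeBasis.orientation_ne_iff_eq_neg, ne_comm, Ne,
        Module.Basis.orientation_eq_iff_det_pos, Module.Basis.det_isUnitSMul]
      simp [orientationSign_neg_basis]

end OrientationSign

/-! ### Charts of a surface with boundary. -/

section Charts

variable {S : Type*} [TopologicalSpace S] [ChartedSpace (EuclideanHalfSpace 2) S]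

/-- An open set of the plane whose trace on the half-plane is the image of `N` under the chart
at `p`. -/
def chartImage (p : S) (N : Set S) : Set Plane :=
  (𝓡∂ 2).symm ⁻¹' ((chartAt (EuclideanHalfSpace 2) p).target ∩
    (chartAt (EuclideanHalfSpace 2) p).symm ⁻¹' N)

lemma isOpen_chartImage (p : S) {N : Set S} (hN : IsOpen N) : IsOpen (chartImage p N) :=
  ((chartAt (EuclideanHalfSpace 2) p).isOpen_inter_preimage_symm hN).preimage
    (𝓡∂ 2).continuous_symm

lemma mem_chartImage {p : S} {N : Set S} {y : Plane} (hy : y ∈ halfPlane) :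
    y ∈ chartImage p N ↔
      y ∈ (extChartAt (𝓡∂ 2) p).target ∧ (extChartAt (𝓡∂ 2) p).symm y ∈ N := by
  rw [extChartAt_target]
  simp only [chartImage, mem_preimage, mem_inter_iff, extChartAt_coe_symm, Function.comp_apply]
  tauto

lemma target_subset_halfPlane (p : S) : (extChartAt (𝓡∂ 2) p).target ⊆ halfPlane :=
  extChartAt_target_subset_range p

lemma chart_mem_halfPlane (p x : S) : extChartAt (𝓡∂ 2) p x ∈ halfPlane :=
  mem_range_self _

/-- The local expression of a function in the chart at `p`. -/
noncomputable def inChart (p : S) (f : S → ℝ) : Plane → ℝ := f ∘ (extChartAt (𝓡∂ 2) p).symm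

lemma mfderiv_eq_fderivWithin_inChart {z : S} {f : S → ℝ}
    (hf : ContMDiff (𝓡∂ 2) 𝓘(ℝ, ℝ) ∞ f) (w : TangentSpace (𝓡∂ 2) z) :
    mfderiv (𝓡∂ 2) 𝓘(ℝ, ℝ) f z w =
      fderivWithin ℝ (inChart z f) halfPlane (extChartAt (𝓡∂ 2) z z) w := by
  rw [(hf.mdifferentiableAt (by simp)).mfderiv]
  rfl

variable [IsManifold (𝓡∂ 2) ∞ S]

/-- Being an interior point can be tested in any chart of the atlas; in a chart of the half-plane
the test is positivity of the zeroth coordinate. -/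
lemma interior_iff_pos {p x : S} (hx : x ∈ (extChartAt (𝓡∂ 2) p).source) :
    x ∈ (𝓡∂ 2).interior S ↔ 0 < extChartAt (𝓡∂ 2) p x 0 := by
  rw [extChartAt_source] at hx
  have h1 : x ∈ (𝓡∂ 2).interior S ↔ _ :=
    ModelWithCorners.isInteriorPoint_iff_of_mem_atlas (I := 𝓡∂ 2) (n := ∞) (by simp)
      (chart_mem_atlas _ p) hx
  rw [h1]
  change extChartAt (𝓡∂ 2) p x ∈ interior (extChartAt (𝓡∂ 2) p).target ↔ _
  rw [extChartAt_target, interior_inter, interior_range_modelWithCornersEuclideanHalfSpace]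
  refine ⟨fun h => h.2, fun h => ⟨?_, h⟩⟩
  rw [((chartAt (EuclideanHalfSpace 2) p).open_target.preimage
    (𝓡∂ 2).continuous_symm).interior_eq]
  change (𝓡∂ 2).symm ((𝓡∂ 2) (chartAt (EuclideanHalfSpace 2) p x)) ∈
    (chartAt (EuclideanHalfSpace 2) p).target
  rw [(𝓡∂ 2).left_inv]
  exact (chartAt (EuclideanHalfSpace 2) p).map_source hx

lemma boundary_iff_zero {p x : S} (hx : x ∈ (extChartAt (𝓡∂ 2) p).source) :
    x ∈ (𝓡∂ 2).boundary S ↔ extChartAt (𝓡∂ 2) p x 0 = 0 := by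
  rw [← ModelWithCorners.compl_interior, mem_compl_iff, interior_iff_pos hx, not_lt]
  exact ⟨fun h => le_antisymm h (mem_halfPlane.1 (chart_mem_halfPlane p x)), fun h => h.le⟩

lemma contDiffOn_inChart {p : S} {f : S → ℝ} (hf : ContMDiff (𝓡∂ 2) 𝓘(ℝ, ℝ) ∞ f)
    (N : Set S) : ContDiffOn ℝ ∞ (inChart p f) (halfPlane ∩ chartImage p N) := by
  have h1 : ContMDiffOn 𝓘(ℝ, Plane) 𝓘(ℝ, ℝ) ∞ (inChart p f) (extChartAt (𝓡∂ 2) p).target :=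
    hf.comp_contMDiffOn (contMDiffOn_extChartAt_symm p)
  exact (contMDiffOn_iff_contDiffOn.1 h1).mono fun y hy => ((mem_chartImage hy.1).1 hy.2).1

lemma differentiableWithinAt_inChart {p : S} {f : S → ℝ} (hf : ContMDiff (𝓡∂ 2) 𝓘(ℝ, ℝ) ∞ f)
    {y : Plane} (hy : y ∈ (extChartAt (𝓡∂ 2) p).target) :
    DifferentiableWithinAt ℝ (inChart p f) halfPlane y := by
  have hyH := target_subset_halfPlane p hy
  have hyV : y ∈ chartImage p univ := (mem_chartImage hyH).2 ⟨hy, mem_univ _⟩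
  have := (contDiffOn_inChart (p := p) hf univ).differentiableOn (by simp) y ⟨hyH, hyV⟩
  rwa [differentiableWithinAt_inter ((isOpen_chartImage p isOpen_univ).mem_nhds hyV)] at this

lemma fderivWithin_inChart {p q z : S} {f : S → ℝ} (hf : ContMDiff (𝓡∂ 2) 𝓘(ℝ, ℝ) ∞ f)
    (hp : z ∈ (extChartAt (𝓡∂ 2) p).source) (hq : z ∈ (extChartAt (𝓡∂ 2) q).source) :
    fderivWithin ℝ (inChart p f) halfPlane (extChartAt (𝓡∂ 2) p z) =
      (fderivWithin ℝ (inChart q f) halfPlane (extChartAt (𝓡∂ 2) q z)).comp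
        (tangentCoordChange (𝓡∂ 2) p q z) := by
  have h1 := hasFDerivWithinAt_tangentCoordChange (I := 𝓡∂ 2) (x := p) (y := q) ⟨hp, hq⟩
  have h2 := (differentiableWithinAt_inChart (p := q) hf
    ((extChartAt (𝓡∂ 2) q).map_source hq)).hasFDerivWithinAt
  have hτ : (extChartAt (𝓡∂ 2) q ∘ (extChartAt (𝓡∂ 2) p).symm) (extChartAt (𝓡∂ 2) p z)
      = extChartAt (𝓡∂ 2) q z := by
    rw [Function.comp_apply, (extChartAt (𝓡∂ 2) p).left_inv hp]
  rw [← hτ] at h2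
  have h3 := h2.comp _ h1 (fun y _ => chart_mem_halfPlane q _)
  rw [hτ] at h3
  refine (h3.congr_of_eventuallyEq ?_ ?_).fderivWithin
    (uniqueDiffOn_halfPlane _ (chart_mem_halfPlane p z))
  · have hn : (extChartAt (𝓡∂ 2) p).symm ⁻¹' (extChartAt (𝓡∂ 2) q).source ∈
        𝓝 (extChartAt (𝓡∂ 2) p z) := by
      refine extChartAt_preimage_mem_nhds' hp (extChartAt_source_mem_nhds' hq)
    filter_upwards [mem_nhdsWithin_of_mem_nhds hn] with y hy
    simp only [inChart, Function.comp_apply]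
    rw [(extChartAt (𝓡∂ 2) q).left_inv hy]
  · simp only [inChart, Function.comp_apply]
    rw [(extChartAt (𝓡∂ 2) p).left_inv hp, (extChartAt (𝓡∂ 2) q).left_inv hq]

/-- The Jacobian is the coefficient of the two-form df ∧ dg, so it transforms by the determinant of
the coordinate change. -/
lemma jac_inChart {p q z : S} {f g : S → ℝ} (hf : ContMDiff (𝓡∂ 2) 𝓘(ℝ, ℝ) ∞ f)
    (hg : ContMDiff (𝓡∂ 2) 𝓘(ℝ, ℝ) ∞ g)
    (hp : z ∈ (extChartAt (𝓡∂ 2) p).source) (hq : z ∈ (extChartAt (𝓡∂ 2) q).source) :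
    jac (inChart p f) (inChart p g) (extChartAt (𝓡∂ 2) p z) =
      (tangentCoordChange (𝓡∂ 2) p q z).det *
        jac (inChart q f) (inChart q g) (extChartAt (𝓡∂ 2) q z) := by
  simp only [jac, partialWithin]
  rw [fderivWithin_inChart hf hp hq, fderivWithin_inChart hg hp hq]
  exact det_pullback _ _ _

/-- Changes of charts map inward or tangent vectors at a boundary point to inward or tangent
vectors. -/
lemma tangentCoordChange_nonneg {p q z : S} (hp : z ∈ (extChartAt (𝓡∂ 2) p).source)
    (hq : z ∈ (extChartAt (𝓡∂ 2) q).source) (hz : z ∈ (𝓡∂ 2).boundary S) {v : Plane}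
    (hv : 0 ≤ v 0) : 0 ≤ tangentCoordChange (𝓡∂ 2) p q z v 0 := by
  have h1 := hasFDerivWithinAt_tangentCoordChange (I := 𝓡∂ 2) (x := p) (y := q) ⟨hp, hq⟩
  have h2 := (EuclideanSpace.proj (𝕜 := ℝ) (0 : Fin 2)).hasFDerivAt.comp_hasFDerivWithinAt _ h1
  -- The zeroth coordinate of a transition map is nonnegative on the half-plane and zero at the
  -- boundary point, so it has a minimum there; its derivative is nonnegative in every direction
  -- pointing into the half-plane.
  have hmin : IsLocalMinOn ((EuclideanSpace.proj (𝕜 := ℝ) (0 : Fin 2)) ∘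
      (extChartAt (𝓡∂ 2) q ∘ (extChartAt (𝓡∂ 2) p).symm)) halfPlane
        (extChartAt (𝓡∂ 2) p z) := by
    refine Filter.Eventually.of_forall fun y => ?_
    change (extChartAt (𝓡∂ 2) q ((extChartAt (𝓡∂ 2) p).symm (extChartAt (𝓡∂ 2) p z))) 0 ≤
      (extChartAt (𝓡∂ 2) q ((extChartAt (𝓡∂ 2) p).symm y)) 0
    rw [(extChartAt (𝓡∂ 2) p).left_inv hp, (boundary_iff_zero hq).1 hz]
    exact mem_halfPlane.1 (chart_mem_halfPlane q _)
  refine hmin.hasFDerivWithinAt_nonneg h2 (mem_posTangentConeAt_of_segment_subset ?_)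
  refine ((𝓡∂ 2).convex_range).segment_subset (chart_mem_halfPlane p z) ?_
  have := mem_halfPlane.1 (chart_mem_halfPlane p z)
  exact mem_halfPlane.2 (by simpa using add_nonneg this hv)

lemma tangentCoordChange_zero {p q z : S} (hp : z ∈ (extChartAt (𝓡∂ 2) p).source)
    (hq : z ∈ (extChartAt (𝓡∂ 2) q).source) (hz : z ∈ (𝓡∂ 2).boundary S) {v : Plane}
    (hv : v 0 = 0) : tangentCoordChange (𝓡∂ 2) p q z v 0 = 0 := by
  refine le_antisymm ?_ (tangentCoordChange_nonneg hp hq hz hv.ge)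
  have := tangentCoordChange_nonneg hp hq hz (v := -v) (by simp [hv])
  rw [map_neg] at this
  simpa using this

lemma tangentCoordChange_cancel {p q z : S} (hp : z ∈ (extChartAt (𝓡∂ 2) p).source)
    (hq : z ∈ (extChartAt (𝓡∂ 2) q).source) (v : Plane) :
    tangentCoordChange (𝓡∂ 2) q p z (tangentCoordChange (𝓡∂ 2) p q z v) = v := by
  rw [tangentCoordChange_comp ⟨⟨hp, hq⟩, hp⟩, tangentCoordChange_self hp]

lemma tangentCoordChange_neg {p q z : S} (hp : z ∈ (extChartAt (𝓡∂ 2) p).source)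
    (hq : z ∈ (extChartAt (𝓡∂ 2) q).source) (hz : z ∈ (𝓡∂ 2).boundary S) {v : Plane}
    (hv : v 0 < 0) : tangentCoordChange (𝓡∂ 2) p q z v 0 < 0 := by
  have h1 := tangentCoordChange_nonneg hp hq hz (v := -v) (by simp [hv.le])
  rw [map_neg] at h1
  -- If the image were tangent to the boundary, the inverse coordinate change would make the
  -- original vector tangent as well.
  refine lt_of_le_of_ne (by simpa using h1) fun h => hv.ne ?_
  have := tangentCoordChange_zero hq hp hz h
  rwa [tangentCoordChange_cancel hp hq] at this

end Charts

/-! ### Integrals of two-forms in charts and their change of variables. -/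

section SurfaceIntegral

lemma integrableOn_of_compact_support {V K : Set Plane} (hV : IsOpen V) (hK : IsCompact K)
    (hKV : K ⊆ V) {f : Plane → ℝ} (hf : ContinuousOn f (halfPlane ∩ V))
    (hf0 : ∀ y ∈ halfPlane ∩ V, y ∉ K → f y = 0) :
    IntegrableOn f (V ∩ {y : Plane | 0 < y 0}) := by
  have hc : IsClosed halfPlane := (𝓡∂ 2).isClosed_range
  have h1 : IntegrableOn f (halfPlane ∩ K) :=
    (hf.mono (inter_subset_inter_right _ hKV)).integrableOn_compact (hK.inter_left hc)
  refine h1.of_forall_sdiff_eq_zero (hV.inter isOpen_zero_lt).measurableSet ?_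
  rintro y ⟨⟨hyV, hy0⟩, hy⟩
  have hyH : y ∈ halfPlane := mem_halfPlane.2 (le_of_lt hy0)
  exact hf0 y ⟨hyH, hyV⟩ fun hyK => hy ⟨hyH, hyK⟩

variable {S : Type*} [TopologicalSpace S] [ChartedSpace (EuclideanHalfSpace 2) S]

lemma chart_mem_chartImage {p x : S} {N : Set S} (hx : x ∈ (extChartAt (𝓡∂ 2) p).source)
    (hN : x ∈ N) : extChartAt (𝓡∂ 2) p x ∈ chartImage p N :=
  (mem_chartImage (chart_mem_halfPlane p x)).2
    ⟨(extChartAt (𝓡∂ 2) p).map_source hx, by rwa [(extChartAt (𝓡∂ 2) p).left_inv hx]⟩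

lemma exists_of_mem_chartImage {p : S} {N : Set S} {y : Plane} (hy : y ∈ halfPlane)
    (hyN : y ∈ chartImage p N) : ∃ x ∈ N, x ∈ (extChartAt (𝓡∂ 2) p).source ∧
      extChartAt (𝓡∂ 2) p x = y ∧ (extChartAt (𝓡∂ 2) p).symm y = x := by
  obtain ⟨h1, h2⟩ := (mem_chartImage hy).1 hyN
  exact ⟨_, h2, (extChartAt (𝓡∂ 2) p).map_target h1, (extChartAt (𝓡∂ 2) p).right_inv h1, rfl⟩

/-- The compact set of the half-plane corresponding to the support of a function. -/
lemma isCompact_chart_tsupport [CompactSpace S] {p : S} {N : Set S} {f : S → ℝ}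
    (hN : N ⊆ (extChartAt (𝓡∂ 2) p).source) (hf : tsupport f ⊆ N) :
    IsCompact (extChartAt (𝓡∂ 2) p '' tsupport f) ∧
      extChartAt (𝓡∂ 2) p '' tsupport f ⊆ chartImage p N := by
  refine ⟨(isClosed_tsupport f).isCompact.image_of_continuousOn
    ((continuousOn_extChartAt p).mono (hf.trans hN)), ?_⟩
  rintro _ ⟨x, hx, rfl⟩
  exact chart_mem_chartImage (hN (hf hx)) (hf hx)

lemma inChart_eq_zero {p : S} {N : Set S} {f : S → ℝ} {y : Plane}
    (hy : y ∈ halfPlane ∩ chartImage p N) (hyK : y ∉ extChartAt (𝓡∂ 2) p '' tsupport f) :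
    inChart p f y = 0 := by
  obtain ⟨x, -, -, hxy, hyx⟩ := exists_of_mem_chartImage hy.1 hy.2
  by_contra h
  refine hyK ⟨x, subset_tsupport f ?_, hxy⟩
  rw [← hyx]; exact h

lemma partialWithin_inChart_eq_zero {p x : S} {f : S → ℝ}
    (hx : x ∈ (extChartAt (𝓡∂ 2) p).source) (hf : x ∉ tsupport f) (k : Fin 2) :
    partialWithin k (inChart p f) (extChartAt (𝓡∂ 2) p x) = 0 := by
  rw [partialWithin_congr (g := fun _ => 0) (chart_mem_halfPlane p x), partialWithin_const]
  have hn : (extChartAt (𝓡∂ 2) p).symm ⁻¹' (tsupport f)ᶜ ∈ 𝓝 (extChartAt (𝓡∂ 2) p x) :=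
    extChartAt_preimage_mem_nhds' hx ((isClosed_tsupport f).isOpen_compl.mem_nhds hf)
  filter_upwards [mem_nhdsWithin_of_mem_nhds hn] with y hy
  exact image_eq_zero_of_notMem_tsupport (f := f) hy

lemma jac_inChart_eq_zero {p x : S} {f : S → ℝ} (g : S → ℝ)
    (hx : x ∈ (extChartAt (𝓡∂ 2) p).source) (hf : x ∉ tsupport f) :
    jac (inChart p f) (inChart p g) (extChartAt (𝓡∂ 2) p x) = 0 := by
  rw [jac, partialWithin_inChart_eq_zero hx hf, partialWithin_inChart_eq_zero hx hf]
  ring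

variable [IsManifold (𝓡∂ 2) ∞ S]

lemma contDiffOn_jac_inChart {p : S} {N : Set S} (hN : IsOpen N) {f g : S → ℝ}
    (hf : ContMDiff (𝓡∂ 2) 𝓘(ℝ, ℝ) ∞ f) (hg : ContMDiff (𝓡∂ 2) 𝓘(ℝ, ℝ) ∞ g) :
    ContDiffOn ℝ ∞ (jac (inChart p f) (inChart p g)) (halfPlane ∩ chartImage p N) := by
  have hV := isOpen_chartImage p hN
  have h1 := contDiffOn_partialWithin hV (contDiffOn_inChart (p := p) hf N)
  have h2 := contDiffOn_partialWithin hV (contDiffOn_inChart (p := p) hg N)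
  exact ((h1 0).mul (h2 1)).sub ((h1 1).mul (h2 0))

lemma integrableOn_mul_jac [CompactSpace S] {p : S} {N : Set S} (hN : IsOpen N)
    (hNs : N ⊆ (extChartAt (𝓡∂ 2) p).source) {G f g : S → ℝ}
    (hG : ContMDiff (𝓡∂ 2) 𝓘(ℝ, ℝ) ∞ G) (hf : ContMDiff (𝓡∂ 2) 𝓘(ℝ, ℝ) ∞ f)
    (hg : ContMDiff (𝓡∂ 2) 𝓘(ℝ, ℝ) ∞ g) (h : tsupport G ⊆ N ∨ tsupport f ⊆ N) :
    IntegrableOn (fun y => inChart p G y * jac (inChart p f) (inChart p g) y)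
      (chartImage p N ∩ {y : Plane | 0 < y 0}) := by
  have hc : ContinuousOn (fun y => inChart p G y * jac (inChart p f) (inChart p g) y)
      (halfPlane ∩ chartImage p N) :=
    ((contDiffOn_inChart hG N).mul (contDiffOn_jac_inChart hN hf hg)).continuousOn
  rcases h with h | h
  · obtain ⟨hK, hKV⟩ := isCompact_chart_tsupport hNs h
    refine integrableOn_of_compact_support (isOpen_chartImage p hN) hK hKV hc fun y hy hyK => ?_
    rw [inChart_eq_zero hy hyK, zero_mul]
  · obtain ⟨hK, hKV⟩ := isCompact_chart_tsupport hNs h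
    refine integrableOn_of_compact_support (isOpen_chartImage p hN) hK hKV hc fun y hy hyK => ?_
    obtain ⟨x, hxN, hx, rfl, -⟩ := exists_of_mem_chartImage hy.1 hy.2
    rw [jac_inChart_eq_zero g hx fun hxt => hyK ⟨x, hxt, rfl⟩, mul_zero]

/-- The integral of the two-form `G df ∧ dg` over the overlap of two charts does not depend on the
chart, up to orientation. -/
lemma integral_mul_jac_eq {p q : S} {P Q : Set S} (hP : IsOpen P) (hQ : IsOpen Q)
    (hPs : P ⊆ (extChartAt (𝓡∂ 2) p).source) (hQs : Q ⊆ (extChartAt (𝓡∂ 2) q).source) {a b : ℝ}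
    (hab : ∀ x ∈ P ∩ Q, a * (tangentCoordChange (𝓡∂ 2) p q x).det =
      b * |(tangentCoordChange (𝓡∂ 2) p q x).det|) {G f g : S → ℝ}
    (hf : ContMDiff (𝓡∂ 2) 𝓘(ℝ, ℝ) ∞ f) (hg : ContMDiff (𝓡∂ 2) 𝓘(ℝ, ℝ) ∞ g)
    (hG : tsupport G ⊆ Q) (hfP : tsupport f ⊆ P) :
    a * ∫ y in chartImage p P ∩ {y : Plane | 0 < y 0},
        inChart p G y * jac (inChart p f) (inChart p g) y =
      b * ∫ y in chartImage q Q ∩ {y : Plane | 0 < y 0},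
        inChart q G y * jac (inChart q f) (inChart q g) y := by
  have hPo := (isOpen_chartImage p hP).inter isOpen_zero_lt
  have hQo := (isOpen_chartImage q hQ).inter isOpen_zero_lt
  have hsub : ∀ (r : S) {N N' : Set S}, N ⊆ N' →
      chartImage r N ∩ {y : Plane | 0 < y 0} ⊆ chartImage r N' ∩ {y : Plane | 0 < y 0} := by
    intro r N N' h
    exact inter_subset_inter_left _ (preimage_mono (inter_subset_inter_right _ (preimage_mono h)))
  -- Both integrals reduce to the overlap of P and Q: in the chart at p the factor G vanishes off Q,
  -- and in the chart at q the Jacobian of f vanishes off P.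
  rw [setIntegral_eq_of_subset_of_forall_sdiff_eq_zero hPo.measurableSet
      (hsub p (inter_subset_left (s := P) (t := Q))),
    setIntegral_eq_of_subset_of_forall_sdiff_eq_zero hQo.measurableSet
      (hsub q (inter_subset_right (s := P) (t := Q)))]
  rotate_left
  · rintro y ⟨⟨hy, hy0⟩, hyn⟩
    have hyH : y ∈ halfPlane := mem_halfPlane.2 (le_of_lt hy0)
    obtain ⟨x, hxN, hx, rfl, -⟩ := exists_of_mem_chartImage hyH hy
    have hxP : x ∉ P := fun h => hyn ⟨chart_mem_chartImage hx ⟨h, hxN⟩, hy0⟩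
    rw [jac_inChart_eq_zero g hx fun h => hxP (hfP h), mul_zero]
  · rintro y ⟨⟨hy, hy0⟩, hyn⟩
    have hyH : y ∈ halfPlane := mem_halfPlane.2 (le_of_lt hy0)
    obtain ⟨x, hxN, hx, rfl, hyx⟩ := exists_of_mem_chartImage hyH hy
    have hxQ : x ∉ Q := fun h => hyn ⟨chart_mem_chartImage hx ⟨hxN, h⟩, hy0⟩
    have : inChart p G (extChartAt (𝓡∂ 2) p x) = 0 := by
      rw [inChart, Function.comp_apply, hyx]
      exact image_eq_zero_of_notMem_tsupport fun h => hxQ (hG h)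
    rw [this, zero_mul]
  set τ : Plane → Plane := extChartAt (𝓡∂ 2) q ∘ (extChartAt (𝓡∂ 2) p).symm with hτ
  set W := chartImage p (P ∩ Q) ∩ {y : Plane | 0 < y 0} with hW
  have hWx : ∀ y ∈ W, ∃ x ∈ P ∩ Q, x ∈ (extChartAt (𝓡∂ 2) p).source ∧
      x ∈ (extChartAt (𝓡∂ 2) q).source ∧ x ∈ (𝓡∂ 2).interior S ∧
      extChartAt (𝓡∂ 2) p x = y ∧ (extChartAt (𝓡∂ 2) p).symm y = x ∧
      τ y = extChartAt (𝓡∂ 2) q x := by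
    rintro y ⟨hy, hy0⟩
    obtain ⟨x, hxN, hx, hxy, hyx⟩ := exists_of_mem_chartImage
      (mem_halfPlane.2 (le_of_lt hy0)) hy
    refine ⟨x, hxN, hx, hQs hxN.2, (interior_iff_pos hx).2 (by rw [hxy]; exact hy0), hxy, hyx, ?_⟩
    rw [hτ, Function.comp_apply, hyx]
  have himage : chartImage q (P ∩ Q) ∩ {y : Plane | 0 < y 0} = τ '' W := by
    ext y
    constructor
    · rintro ⟨hy, hy0⟩
      obtain ⟨x, hxN, hx, hxy, hyx⟩ := exists_of_mem_chartImage
        (mem_halfPlane.2 (le_of_lt hy0)) hy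
      have hxp := hPs hxN.1
      refine ⟨extChartAt (𝓡∂ 2) p x, ⟨chart_mem_chartImage hxp hxN, ?_⟩, ?_⟩
      · exact (interior_iff_pos hxp).1 ((interior_iff_pos hx).2 (by rw [hxy]; exact hy0))
      · rw [hτ, Function.comp_apply, (extChartAt (𝓡∂ 2) p).left_inv hxp, hxy]
    · rintro ⟨y, hy, rfl⟩
      obtain ⟨x, hxN, hxp, hxq, hxi, -, -, hty⟩ := hWx y hy
      rw [hty]
      exact ⟨chart_mem_chartImage hxq hxN, (interior_iff_pos hxq).1 hxi⟩
  have hinj : InjOn τ W := by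
    intro y hy y' hy' h
    obtain ⟨x, -, -, hxq, -, hxy, -, hty⟩ := hWx y hy
    obtain ⟨x', -, -, hxq', -, hxy', -, hty'⟩ := hWx y' hy'
    rw [← hxy, ← hxy', (extChartAt (𝓡∂ 2) q).injOn hxq hxq' (by rw [← hty, ← hty', h])]
  have hder : ∀ y ∈ W, HasFDerivWithinAt τ
      (tangentCoordChange (𝓡∂ 2) p q ((extChartAt (𝓡∂ 2) p).symm y)) W y := by
    intro y hy
    obtain ⟨x, -, hxp, hxq, -, hxy, hyx, -⟩ := hWx y hy
    have := hasFDerivWithinAt_tangentCoordChange (I := 𝓡∂ 2) (x := p) (y := q) ⟨hxp, hxq⟩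
    rw [hyx, ← hxy]
    exact this.mono fun z hz => mem_halfPlane.2 (le_of_lt hz.2)
  have hWm : MeasurableSet W :=
    ((isOpen_chartImage p (hP.inter hQ)).inter isOpen_zero_lt).measurableSet
  rw [himage, integral_image_eq_integral_abs_det_fderiv_smul volume hWm hder hinj,
    ← integral_const_mul, ← integral_const_mul]
  refine setIntegral_congr_fun hWm fun y hy => ?_
  obtain ⟨x, hxN, hxp, hxq, -, hxy, hyx, hty⟩ := hWx y hy
  have h1 : inChart p G y = G x := by rw [inChart, Function.comp_apply, hyx]
  have h2 : inChart q G (τ y) = G x := by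
    rw [inChart, Function.comp_apply, hty, (extChartAt (𝓡∂ 2) q).left_inv hxq]
  simp only [smul_eq_mul]
  rw [h1, h2, hyx, hty, ← hxy, jac_inChart hf hg hxp hxq]
  linear_combination (G x * jac (inChart q f) (inChart q g) (extChartAt (𝓡∂ 2) q x)) * hab x hxN

/-- Stokes' theorem in one chart. -/
lemma integral_jac_inChart [CompactSpace S] {p : S} {N : Set S} (hN : IsOpen N)
    (hNs : N ⊆ (extChartAt (𝓡∂ 2) p).source) {f g : S → ℝ}
    (hf : ContMDiff (𝓡∂ 2) 𝓘(ℝ, ℝ) ∞ f) (hg : ContMDiff (𝓡∂ 2) 𝓘(ℝ, ℝ) ∞ g)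
    (h : tsupport f ⊆ N) :
    ∫ y in chartImage p N ∩ {y : Plane | 0 < y 0}, jac (inChart p f) (inChart p g) y =
      - ∫ t : ℝ, (chartImage p N).indicator
        (fun y => inChart p f y * partialWithin 1 (inChart p g) y) !₂[0, t] := by
  obtain ⟨hK, hKV⟩ := isCompact_chart_tsupport hNs h
  exact integral_jac_halfPlane (isOpen_chartImage p hN) hK hKV (contDiffOn_inChart hf N)
    (contDiffOn_inChart hg N) fun y hy hyK => inChart_eq_zero hy hyK

end SurfaceIntegral

/-! ### Stokes' theorem on a compact oriented surface. -/

lemma IsPositiveFrame.symm_comp {V W : Type*} [AddCommGroup V] [Module ℝ V] [AddCommGroup W]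
    [Module ℝ W] {n : ℕ} (L : V ≃ₗ[ℝ] W) {o : Orientation ℝ V (Fin n)}
    {o' : Orientation ℝ W (Fin n)} (h : Orientation.map (Fin n) L o = o') {f : Fin n → W}
    (hf : IsPositiveFrame o' f) : IsPositiveFrame o (L.symm ∘ f) := by
  obtain ⟨b, hb, hbo⟩ := hf
  refine ⟨b.map L.symm, ?_, ?_⟩
  · rw [← hb]; ext i; simp
  · rw [Module.Basis.orientation_map, hbo, ← h, ← Orientation.map_symm]
    exact Equiv.symm_apply_apply _ _

lemma orientation_map_trans {V W U : Type*} [AddCommGroup V] [Module ℝ V] [AddCommGroup W]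
    [Module ℝ W] [AddCommGroup U] [Module ℝ U] {n : ℕ} (e : V ≃ₗ[ℝ] W) (f : W ≃ₗ[ℝ] U)
    (o : Orientation ℝ V (Fin n)) :
    Orientation.map (Fin n) (e.trans f) o =
      Orientation.map (Fin n) f (Orientation.map (Fin n) e o) := by
  induction o using Module.Ray.ind with
  | h v hv => rfl

section SurfaceStokes

variable {S : Type*} [TopologicalSpace S] [ChartedSpace (EuclideanHalfSpace 2) S]

/-- The differential of a real function on a surface, as a real valued function. -/
noncomputable def differential (f : S → ℝ) (z : S) (w : TangentSpace (𝓡∂ 2) z) : ℝ :=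
  mfderiv (𝓡∂ 2) 𝓘(ℝ, ℝ) f z w

variable [IsManifold (𝓡∂ 2) ∞ S]

lemma partialWithin_eq_differential {p z : S} {f : S → ℝ}
    (hf : ContMDiff (𝓡∂ 2) 𝓘(ℝ, ℝ) ∞ f) (hp : z ∈ (extChartAt (𝓡∂ 2) p).source) (k : Fin 2) :
    partialWithin k (inChart p f) (extChartAt (𝓡∂ 2) p z) =
      differential f z (tangentCoordChange (𝓡∂ 2) p z z (EuclideanSpace.single k 1)) := by
  rw [partialWithin, fderivWithin_inChart hf hp (mem_extChartAt_source z)]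
  exact (mfderiv_eq_fderivWithin_inChart hf _).symm

/-- Connects the trivializations used to define orientations with the coordinate changes used for
integration. -/
lemma continuousLinearEquivAt_apply {p z : S}
    (hz : z ∈ (trivializationAt (EuclideanSpace ℝ (Fin 2)) (TangentSpace (𝓡∂ 2)) p).baseSet)
    (v : TangentSpace (𝓡∂ 2) z) :
    (trivializationAt (EuclideanSpace ℝ (Fin 2)) (TangentSpace (𝓡∂ 2)) p).continuousLinearEquivAt
      ℝ z hz v = tangentCoordChange (𝓡∂ 2) z p z v := by
  have hz' : z ∈ (chartAt (EuclideanHalfSpace 2) p).source := hz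
  refine (congrFun (Bundle.Trivialization.coe_continuousLinearEquivAt_eq _ hz) v).trans ?_
  exact DFunLike.congr_fun
    (TangentBundle.continuousLinearMapAt_trivializationAt_eq_core (I := 𝓡∂ 2) hz') v

lemma continuousLinearEquivAt_symm_apply {p z : S}
    (hz : z ∈ (trivializationAt (EuclideanSpace ℝ (Fin 2)) (TangentSpace (𝓡∂ 2)) p).baseSet)
    (v : Plane) :
    ((trivializationAt (EuclideanSpace ℝ (Fin 2)) (TangentSpace (𝓡∂ 2)) p).continuousLinearEquivAt
      ℝ z hz).symm v = tangentCoordChange (𝓡∂ 2) p z z v := by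
  have hz' : z ∈ (extChartAt (𝓡∂ 2) p).source := by rw [extChartAt_source]; exact hz
  refine (ContinuousLinearEquiv.symm_apply_eq _).2 ?_
  refine Eq.trans ?_ (continuousLinearEquivAt_apply hz _).symm
  exact (tangentCoordChange_cancel hz' (mem_extChartAt_source z) v).symm

/-- The orientation of the tangent space at `p`, transported to the plane by the chart at `p`. -/
def chartOrientation (oS : ManifoldOrientation (𝓡∂ 2) S) (p : S) :
    Orientation ℝ Plane (Fin 2) := oS.at' p

/-- The orientation is constant, in the chart at `p`, on the set `N`. -/
def IsOrientedBy (oS : ManifoldOrientation (𝓡∂ 2) S) (p : S) (N : Set S) : Prop :=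
  ∀ x ∈ N, ∀ hx : x ∈ (trivializationAt (EuclideanSpace ℝ (Fin 2))
      (TangentSpace (𝓡∂ 2)) p).baseSet,
    Orientation.map (Fin 2)
      ((trivializationAt (EuclideanSpace ℝ (Fin 2)) (TangentSpace (𝓡∂ 2)) p).continuousLinearEquivAt
        ℝ x hx).toLinearEquiv (oS.at' x) = chartOrientation oS p

lemma exists_isOrientedBy (oS : ManifoldOrientation (𝓡∂ 2) S) (p : S) :
    ∃ N : Set S, IsOpen N ∧ p ∈ N ∧ N ⊆ (extChartAt (𝓡∂ 2) p).source ∧ IsOrientedBy oS p N := by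
  obtain ⟨N, hN, hNo, hpN⟩ := eventually_nhds_iff.1 (oS.locallyConstant p)
  refine ⟨N ∩ (extChartAt (𝓡∂ 2) p).source, hNo.inter (isOpen_extChartAt_source p),
    ⟨hpN, mem_extChartAt_source p⟩, inter_subset_right, fun x hx => hN x hx.1⟩

/-- Each of the two charts carries the orientation at x to its own constant orientation, so the
transition map carries one constant to the other and the determinant identity for planes applies. -/
lemma orientationSign_tangentCoordChange {oS : ManifoldOrientation (𝓡∂ 2) S} {p q x : S}
    {P Q : Set S} (hP : IsOrientedBy oS p P) (hQ : IsOrientedBy oS q Q)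
    (hPs : P ⊆ (extChartAt (𝓡∂ 2) p).source) (hQs : Q ⊆ (extChartAt (𝓡∂ 2) q).source)
    (hx : x ∈ P ∩ Q) :
    orientationSign (chartOrientation oS p) * (tangentCoordChange (𝓡∂ 2) p q x).det =
      orientationSign (chartOrientation oS q) * |(tangentCoordChange (𝓡∂ 2) p q x).det| := by
  have hxp := hPs hx.1
  have hxq := hQs hx.2
  rw [extChartAt_source] at hxp hxq
  set Tp := (trivializationAt (EuclideanSpace ℝ (Fin 2))
    (TangentSpace (𝓡∂ 2)) p).continuousLinearEquivAt ℝ x hxp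
  set Tq := (trivializationAt (EuclideanSpace ℝ (Fin 2))
    (TangentSpace (𝓡∂ 2)) q).continuousLinearEquivAt ℝ x hxq
  have h1 : Orientation.map (Fin 2) Tp.toLinearEquiv (oS.at' x) = _ := hP x hx.1 hxp
  have h2 : Orientation.map (Fin 2) Tq.toLinearEquiv (oS.at' x) = _ := hQ x hx.2 hxq
  have h3 : Orientation.map (Fin 2) (Tp.toLinearEquiv.symm.trans Tq.toLinearEquiv)
      (chartOrientation oS p) = chartOrientation oS q := by
    rw [← h1, ← h2, orientation_map_trans, ← Orientation.map_symm]
    exact congrArg _ (Equiv.symm_apply_apply _ _)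
  have h4 : (tangentCoordChange (𝓡∂ 2) p q x).det =
      LinearMap.det (Tp.toLinearEquiv.symm.trans Tq.toLinearEquiv : Plane →ₗ[ℝ] Plane) := by
    rw [ContinuousLinearMap.det]
    congr 1
    ext1 v
    have hv : (Tp.toLinearEquiv.symm.trans Tq.toLinearEquiv) v = Tq (Tp.symm v) := rfl
    change _ = (Tp.toLinearEquiv.symm.trans Tq.toLinearEquiv) v
    rw [hv]
    have h5 : Tp.symm v = tangentCoordChange (𝓡∂ 2) p x x v :=
      continuousLinearEquivAt_symm_apply hxp v
    refine Eq.trans ?_ ((continuousLinearEquivAt_apply hxq _).trans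
      (congrArg (tangentCoordChange (𝓡∂ 2) x q x) h5)).symm
    exact (tangentCoordChange_comp ⟨⟨hPs hx.1, mem_extChartAt_source x⟩, hQs hx.2⟩).symm
  rw [h4]
  exact orientationSign_mul_det _ h3

/-- If the one-form `A dB` is nonnegative on the oriented boundary, it has a sign in the charts. -/
lemma boundary_sign {oS : ManifoldOrientation (𝓡∂ 2) S} {A B : S → ℝ}
    (hB : ContMDiff (𝓡∂ 2) 𝓘(ℝ, ℝ) ∞ B)
    (hbd : ∀ z ∈ (𝓡∂ 2).boundary S, ∀ ν w : TangentSpace (𝓡∂ 2) z, inwardCoord ν < 0 →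
      inwardCoord w = 0 → IsPositiveFrame (oS.at' z) ![ν, w] → 0 ≤ A z * differential B z w)
    {p z : S} {N : Set S} (hN : IsOrientedBy oS p N) (hNs : N ⊆ (extChartAt (𝓡∂ 2) p).source)
    (hzN : z ∈ N) (hz : z ∈ (𝓡∂ 2).boundary S) :
    0 ≤ -orientationSign (chartOrientation oS p) *
      (A z * partialWithin 1 (inChart p B) (extChartAt (𝓡∂ 2) p z)) := by
  have hzp := hNs hzN
  have hzp' := hzp
  rw [extChartAt_source] at hzp'
  have hzz := mem_extChartAt_source (I := 𝓡∂ 2) z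
  set s := orientationSign (chartOrientation oS p) with hs
  -- In the half-plane the outward vector is -e₀, and -s e₁ completes it to a positive frame; pulled
  -- back to z, this gives the test vectors for `hbd`.
  have hfr := (isPositiveFrame_plane (chartOrientation oS p)).symm_comp _ (hN z hzN hzp')
  set L := tangentCoordChange (𝓡∂ 2) p z z with hL
  have hfr' : IsPositiveFrame (oS.at' z) ![(L (-EuclideanSpace.single 0 1) :
      TangentSpace (𝓡∂ 2) z), L ((-s) • EuclideanSpace.single 1 1)] := by
    convert hfr using 1
    ext i
    fin_cases i
    · exact (continuousLinearEquivAt_symm_apply hzp' _).symm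
    · exact (continuousLinearEquivAt_symm_apply hzp' _).symm
  have := hbd z hz _ _ ?_ ?_ hfr'
  · rw [partialWithin_eq_differential hB hzp]
    have hlin : differential B z (L ((-s) • EuclideanSpace.single 1 1)) =
        -s * differential B z (L (EuclideanSpace.single 1 1)) := by
      rw [map_smul]
      exact (mfderiv (𝓡∂ 2) 𝓘(ℝ, ℝ) B z).map_smul (-s) _
    rw [hlin] at this
    linarith
  · exact tangentCoordChange_neg hzp hzz hz (by simp)
  · exact tangentCoordChange_zero hzp hzz hz (by simp)

end SurfaceStokes

lemma jac_mul {f g h : Plane → ℝ} {y : Plane} (hy : y ∈ halfPlane)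
    (hf : DifferentiableWithinAt ℝ f halfPlane y) (hg : DifferentiableWithinAt ℝ g halfPlane y) :
    jac (fun x => f x * g x) h y = g y * jac f h y + f y * jac g h y := by
  simp only [jac]
  rw [partialWithin_mul hy hf hg, partialWithin_mul hy hf hg]
  ring

lemma partialWithin_sum {ι : Type*} [Fintype ι] {f : ι → Plane → ℝ} {y : Plane}
    (hy : y ∈ halfPlane) (hf : ∀ i, DifferentiableWithinAt ℝ (f i) halfPlane y) (k : Fin 2) :
    partialWithin k (fun x => ∑ i, f i x) y = ∑ i, partialWithin k (f i) y := by
  rw [partialWithin, fderivWithin_fun_sum (uniqueDiffOn_halfPlane y hy) fun i _ => hf i]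
  simp [partialWithin]

/-- The differentials of functions with constant sum add up to zero. It is applied to a partition of
unity. -/
lemma sum_jac_eq_zero {ι : Type*} [Fintype ι] {f : ι → Plane → ℝ} {c : ℝ} (g : Plane → ℝ)
    {y : Plane} (hy : y ∈ halfPlane) (hf : ∀ i, DifferentiableWithinAt ℝ (f i) halfPlane y)
    (hc : ∀ x, ∑ i, f i x = c) : ∑ i, jac (f i) g y = 0 := by
  have h : ∀ k, ∑ i, partialWithin k (f i) y = 0 := by
    intro k
    rw [← partialWithin_sum hy hf, funext hc, partialWithin_const]
  simp only [jac, Finset.sum_sub_distrib, ← Finset.sum_mul, h, zero_mul, sub_self]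

/-- A continuous nonnegative function with compact support and zero integral vanishes. -/
lemma eq_zero_of_integral_eq_zero {φ : ℝ → ℝ} (hφ : Continuous φ) (hs : HasCompactSupport φ)
    (h0 : ∀ t, 0 ≤ φ t) (hi : ∫ t, φ t = 0) (t : ℝ) : φ t = 0 := by
  have h1 := (integral_eq_zero_iff_of_nonneg h0 (hφ.integrable_of_hasCompactSupport hs)).1 hi
  exact congrFun ((hφ.ae_eq_iff_eq (volume : Measure ℝ) continuous_zero).1 h1) t

lemma continuous_boundary_slice {V K : Set Plane} (hV : IsOpen V) (hK : IsCompact K)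
    (hKV : K ⊆ V) {f : Plane → ℝ} (hf : ContDiffOn ℝ ∞ f (halfPlane ∩ V))
    (hf0 : ∀ y ∈ halfPlane ∩ V, y ∉ K → f y = 0) :
    Continuous (fun t : ℝ => V.indicator f !₂[0, t]) ∧
      HasCompactSupport (fun t : ℝ => V.indicator f !₂[0, t]) := by
  have hmem : ∀ t : ℝ, (!₂[0, t] : Plane) ∈ halfPlane := fun t => mem_halfPlane.2 le_rfl
  have hcont : Continuous (fun t : ℝ => (!₂[0, t] : Plane)) :=
    planeEquiv.continuous.comp (by fun_prop : Continuous fun t : ℝ => ((0 : ℝ), t))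
  refine ⟨(contDiffOn_indicator_of_compact hV hK hKV hf hf0).continuousOn.comp_continuous
    hcont hmem, ?_⟩
  refine HasCompactSupport.intro (hK.image (f := fun y : Plane => y 1) (by fun_prop)) fun t ht => ?_
  have htK : (!₂[0, t] : Plane) ∉ K := fun h => ht ⟨_, h, rfl⟩
  by_cases htV : (!₂[0, t] : Plane) ∈ V
  · rw [indicator_of_mem htV]
    exact hf0 _ ⟨hmem t, htV⟩ htK
  · exact indicator_of_notMem htV _

section SurfaceStokes

variable {S : Type*} [TopologicalSpace S] [ChartedSpace (EuclideanHalfSpace 2) S]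
  [IsManifold (𝓡∂ 2) ∞ S]

lemma jac_inChart_eq_zero_of_differential {A B : S → ℝ} (hA : ContMDiff (𝓡∂ 2) 𝓘(ℝ, ℝ) ∞ A)
    (hB : ContMDiff (𝓡∂ 2) 𝓘(ℝ, ℝ) ∞ B)
    (hAB : ∀ x (v w : TangentSpace (𝓡∂ 2) x),
      differential A x v * differential B x w = differential A x w * differential B x v)
    {p x : S} (hx : x ∈ (extChartAt (𝓡∂ 2) p).source) :
    jac (inChart p A) (inChart p B) (extChartAt (𝓡∂ 2) p x) = 0 := by
  simp only [jac]
  rw [partialWithin_eq_differential hA hx, partialWithin_eq_differential hA hx,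
    partialWithin_eq_differential hB hx, partialWithin_eq_differential hB hx]
  exact sub_eq_zero.2 (hAB x _ _)

/-- Stokes' theorem for the closed one-form `A dB` on a compact oriented surface: if the form is
nonnegative on the oriented boundary, then it vanishes there. -/
theorem boundary_form_eq_zero [T2Space S] [CompactSpace S] (oS : ManifoldOrientation (𝓡∂ 2) S)
    {A B : S → ℝ} (hA : ContMDiff (𝓡∂ 2) 𝓘(ℝ, ℝ) ∞ A) (hB : ContMDiff (𝓡∂ 2) 𝓘(ℝ, ℝ) ∞ B)
    (hAB : ∀ x (v w : TangentSpace (𝓡∂ 2) x),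
      differential A x v * differential B x w = differential A x w * differential B x v)
    (hbd : ∀ z ∈ (𝓡∂ 2).boundary S, ∀ ν w : TangentSpace (𝓡∂ 2) z, inwardCoord ν < 0 →
      inwardCoord w = 0 → IsPositiveFrame (oS.at' z) ![ν, w] → 0 ≤ A z * differential B z w)
    {z : S} (hz : z ∈ (𝓡∂ 2).boundary S) {w : TangentSpace (𝓡∂ 2) z} (hw : inwardCoord w = 0) :
    A z * differential B z w = 0 := by
  choose N hNo hpN hNs hNor using exists_isOrientedBy oS
  obtain ⟨F, hF⟩ := isCompact_univ.elim_finite_subcover N hNo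
    (fun x _ => mem_iUnion.2 ⟨x, hpN x⟩)
  obtain ⟨ρ, hρ⟩ := SmoothPartitionOfUnity.exists_isSubordinate (𝓡∂ 2) (isClosed_univ (X := S))
    (fun i : F => N i) (fun i => hNo i) (fun x hx => by
      obtain ⟨p, hp, hxp⟩ := mem_iUnion₂.1 (hF hx)
      exact mem_iUnion.2 ⟨⟨p, hp⟩, hxp⟩)
  have hsum : ∀ x, ∑ i, ρ i x = 1 := by
    intro x
    rw [← finsum_eq_sum_of_fintype]
    exact ρ.sum_eq_one (mem_univ x)
  have hρs : ∀ i, ContMDiff (𝓡∂ 2) 𝓘(ℝ, ℝ) ∞ (ρ i) := fun i => (ρ i).contMDiff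
  have hρN : ∀ i, tsupport (ρ i) ⊆ N i := hρ
  have hρA : ∀ i, ContMDiff (𝓡∂ 2) 𝓘(ℝ, ℝ) ∞ (fun x => ρ i x * A x) := fun i => (hρs i).mul hA
  have hρAN : ∀ i, tsupport (fun x => ρ i x * A x) ⊆ N i :=
    fun i => (tsupport_mul_subset_left (f := ρ i) (g := A)).trans (hρN i)
  set s : F → ℝ := fun i => orientationSign (chartOrientation oS i) with hs
  set C : F → Set Plane := fun i => chartImage (i : S) (N i) ∩ {y : Plane | 0 < y 0} with hC
  have hCm : ∀ i, MeasurableSet (C i) := fun i =>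
    ((isOpen_chartImage (i : S) (hNo i)).inter isOpen_zero_lt).measurableSet
  -- `J k j i` is the integral of ρ_j A dρ_i ∧ dB, computed in the chart k; only k = i and k = j are
  -- used.
  set J : F → F → F → ℝ := fun k j i => ∫ y in C k,
    inChart (k : S) (fun x => ρ j x * A x) y * jac (inChart (k : S) (ρ i)) (inChart (k : S) B) y
    with hJ
  have hCx : ∀ i, ∀ y ∈ C i, y ∈ halfPlane ∧ y ∈ (extChartAt (𝓡∂ 2) (i : S)).target ∧
      ∃ x ∈ (extChartAt (𝓡∂ 2) (i : S)).source, extChartAt (𝓡∂ 2) (i : S) x = y := by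
    rintro i y ⟨hy, hy0⟩
    have hyH : y ∈ halfPlane := mem_halfPlane.2 (le_of_lt hy0)
    obtain ⟨x, -, hx, hxy, -⟩ := exists_of_mem_chartImage hyH hy
    exact ⟨hyH, ((mem_chartImage hyH).1 hy).1, x, hx, hxy⟩
  set φ : F → ℝ → ℝ := fun i t => (chartImage (i : S) (N i)).indicator (fun y =>
    inChart (i : S) (fun x => ρ i x * A x) y * partialWithin 1 (inChart (i : S) B) y) !₂[0, t]
    with hφ
  -- Summing over j removes ρ_j and leaves A dρ_i ∧ dB, which equals d(ρ_i A) ∧ dB since dA ∧ dB =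
  -- 0.
  have hstokes : ∀ i, ∑ j, J i j i = - ∫ t, φ i t := by
    intro i
    rw [← integral_jac_inChart (hNo i) (hNs i) (hρA i) hB (hρAN i), hJ, ← integral_finsetSum]
    · refine setIntegral_congr_fun (hCm i) fun y hy => ?_
      obtain ⟨hyH, hyT, x, hx, hxy⟩ := hCx i y hy
      have h1 := jac_mul (h := inChart (i : S) B) hyH
        (differentiableWithinAt_inChart (hρs i) hyT) (differentiableWithinAt_inChart hA hyT)
      have h2 : jac (inChart (i : S) A) (inChart (i : S) B) y = 0 := by
        rw [← hxy]; exact jac_inChart_eq_zero_of_differential hA hB hAB hx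
      rw [h2, mul_zero, add_zero] at h1
      refine Eq.trans ?_ h1.symm
      rw [← Finset.sum_mul]
      congr 1
      simp only [inChart, Function.comp_apply, ← Finset.sum_mul, hsum, one_mul]
    · intro j _
      exact integrableOn_mul_jac (hNo i) (hNs i) (hρA j) (hρs i) hB (Or.inr (hρN i))
  have hzero : ∀ j, ∑ i, J j j i = 0 := by
    intro j
    rw [hJ, ← integral_finsetSum]
    · rw [setIntegral_congr_fun (g := fun _ => 0) (hCm j)]
      · simp
      · intro y hy
        obtain ⟨hyH, hyT, x, hx, hxy⟩ := hCx j y hy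
        simp only [← Finset.mul_sum]
        rw [sum_jac_eq_zero (c := 1) _ hyH
          (fun i => differentiableWithinAt_inChart (hρs i) hyT)
          (fun x => by simp only [inChart, Function.comp_apply, hsum]), mul_zero]
    · intro i _
      exact integrableOn_mul_jac (hNo j) (hNs j) (hρA j) (hρs i) hB (Or.inl (hρAN j))
  have hchange : ∀ i j, s i * J i j i = s j * J j j i := by
    intro i j
    exact integral_mul_jac_eq (hNo i) (hNo j) (hNs i) (hNs j)
      (fun x hx => orientationSign_tangentCoordChange (hNor i) (hNor j) (hNs i) (hNs j) hx)
      (hρs i) hB (hρAN j) (hρN i)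
  -- Move each `J i j i` to the chart j, then exchange the sums so that the inner one is `hzero`.
  have htotal : ∑ i, ∫ t, -s i * φ i t = 0 := by
    have h1 : ∀ i, ∫ t, -s i * φ i t = ∑ j, s j * J j j i := by
      intro i
      rw [integral_const_mul, neg_mul, ← mul_neg, ← hstokes, Finset.mul_sum]
      exact Finset.sum_congr rfl fun j _ => hchange i j
    simp only [h1]
    rw [Finset.sum_comm]
    simp only [← Finset.mul_sum, hzero, mul_zero, Finset.sum_const_zero]
  have hφ0 : ∀ i t, 0 ≤ -s i * φ i t := by
    intro i t
    have htH : (!₂[0, t] : Plane) ∈ halfPlane := mem_halfPlane.2 le_rfl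
    by_cases ht : (!₂[0, t] : Plane) ∈ chartImage (i : S) (N i)
    · obtain ⟨x, hxN, hx, hxy, hyx⟩ := exists_of_mem_chartImage htH ht
      have hxb : x ∈ (𝓡∂ 2).boundary S := (boundary_iff_zero hx).2 (by rw [hxy]; rfl)
      have h1 := mul_nonneg (ρ.nonneg i x)
        (boundary_sign hB hbd (hNor i) (hNs i) hxN hxb)
      have h2 : φ i t = ρ i x * A x * partialWithin 1 (inChart (i : S) B)
          (extChartAt (𝓡∂ 2) (i : S) x) := by
        rw [hφ]
        simp only
        rw [indicator_of_mem ht, inChart, Function.comp_apply, hyx, hxy]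
      rw [h2]
      linarith
    · have h2 : φ i t = 0 := indicator_of_notMem ht _
      rw [h2, mul_zero]
  -- A vanishing sum of nonnegative boundary integrals forces each of them to vanish, and then, by
  -- continuity, each integrand.
  have hφi : ∀ i, ∫ t, -s i * φ i t = 0 := fun i =>
    (Finset.sum_eq_zero_iff_of_nonneg (fun i _ => integral_nonneg (hφ0 i))).1 htotal i
      (Finset.mem_univ i)
  have hφz : ∀ i t, -s i * φ i t = 0 := by
    intro i
    obtain ⟨hK, hKV⟩ := isCompact_chart_tsupport (hNs i) (hρAN i)
    have hV := isOpen_chartImage (i : S) (hNo i)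
    obtain ⟨h1, h2⟩ := continuous_boundary_slice hV hK hKV
      ((contDiffOn_inChart (hρA i) (N i)).mul
        (contDiffOn_partialWithin hV (contDiffOn_inChart hB (N i)) 1))
      (fun y hy hyK => by rw [inChart_eq_zero hy hyK, zero_mul])
    exact eq_zero_of_integral_eq_zero (continuous_const.mul h1) h2.mul_left (hφ0 i) (hφi i)
  obtain ⟨i, hi⟩ := ρ.exists_pos_of_mem (mem_univ z)
  have hzN : z ∈ N i := hρN i (subset_tsupport _ hi.ne')
  have hzs := hNs i hzN
  have hzz := mem_extChartAt_source (I := 𝓡∂ 2) z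
  have hy : (!₂[0, extChartAt (𝓡∂ 2) (i : S) z 1] : Plane) = extChartAt (𝓡∂ 2) (i : S) z := by
    ext k
    fin_cases k
    · exact ((boundary_iff_zero hzs).1 hz).symm
    · rfl
  have hsi : -s i ≠ 0 := by
    rw [hs]; simp only [orientationSign]; split_ifs <;> simp
  have h1 : φ i (extChartAt (𝓡∂ 2) (i : S) z 1) = ρ i z * A z *
      partialWithin 1 (inChart (i : S) B) (extChartAt (𝓡∂ 2) (i : S) z) := by
    rw [hφ]
    simp only
    rw [hy, indicator_of_mem (chart_mem_chartImage hzs hzN), inChart, Function.comp_apply,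
      (extChartAt (𝓡∂ 2) (i : S)).left_inv hzs]
  have h2 := (mul_eq_zero.1 (hφz i (extChartAt (𝓡∂ 2) (i : S) z 1))).resolve_left hsi
  rw [h1, mul_assoc] at h2
  have h3 := (mul_eq_zero.1 h2).resolve_left hi.ne'
  rw [partialWithin_eq_differential hB hzs] at h3
  set u : Plane := tangentCoordChange (𝓡∂ 2) z i z w with hu
  have hu0 : u 0 = 0 := tangentCoordChange_zero hzz hzs hz hw
  -- The boundary tangent line at z is spanned by the image of e₁ under the chart i, so the
  -- vanishing of ∂₁B found there gives the claim for w.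
  have hwu : w = u 1 • (tangentCoordChange (𝓡∂ 2) (i : S) z z (EuclideanSpace.single 1 1) :
      TangentSpace (𝓡∂ 2) z) := by
    have h4 : tangentCoordChange (𝓡∂ 2) (i : S) z z u = w := tangentCoordChange_cancel hzz hzs w
    have h6 : u = u 1 • EuclideanSpace.single 1 1 := by
      conv_lhs => rw [plane_eq u, hu0, zero_smul, zero_add]
    rw [h6] at h4
    exact h4.symm.trans ((tangentCoordChange (𝓡∂ 2) (i : S) z z).map_smul _ _)
  have h5 : differential B z w = u 1 * differential B z
      (tangentCoordChange (𝓡∂ 2) (i : S) z z (EuclideanSpace.single 1 1)) := by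
    exact (congrArg (differential B z) hwu).trans
      ((mfderiv (𝓡∂ 2) 𝓘(ℝ, ℝ) B z).map_smul _ _)
  rw [h5]
  linear_combination u 1 * h3

end SurfaceStokes

/-! ### Slice charts of an embedded surface. -/

section Slice

variable {M : Type*} [TopologicalSpace M] [ChartedSpace (EuclideanSpace ℝ (Fin 3)) M]

/-- The derivative of a real function along a vector field. -/
noncomputable def lieDeriv (X : ∀ x : M, TangentSpace (𝓡 3) x) (f : M → ℝ) (x : M) : ℝ :=
  mfderiv (𝓡 3) 𝓘(ℝ, ℝ) f x (X x)

variable {T : Type*} [TopologicalSpace T] [ChartedSpace (EuclideanSpace ℝ (Fin 2)) T]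

/-- Coordinates `κ` of the three-manifold `M` near `j p`, with inverse `σ`, in which the image of
`j` is a coordinate plane. -/
structure IsSliceChart (j : T → M) (p : T) (κ : M → EuclideanSpace ℝ (Fin 2) × ℝ)
    (σ : EuclideanSpace ℝ (Fin 2) × ℝ → M) (U : Set M)
    (W : Set (EuclideanSpace ℝ (Fin 2) × ℝ)) : Prop where
  isOpen_source : IsOpen U
  isOpen_target : IsOpen W
  mem_source : j p ∈ U
  mapsTo : MapsTo κ U W
  left_inv : ∀ x ∈ U, σ (κ x) = x
  smooth : ContMDiffOn (𝓡 3) 𝓘(ℝ, EuclideanSpace ℝ (Fin 2) × ℝ) ∞ κ U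
  smooth_symm : ContMDiffOn 𝓘(ℝ, EuclideanSpace ℝ (Fin 2) × ℝ) (𝓡 3) ∞ σ W
  snd_eq_zero : ∀ x ∈ U, x ∈ range j → (κ x).2 = 0
  mem_range : ∀ w ∈ W, w.2 = 0 → σ w ∈ range j
  slice_mem : ∀ w ∈ W, (w.1, (0 : ℝ)) ∈ W

lemma finrank_complement {F : Type*} [NormedAddCommGroup F] [NormedSpace ℝ F]
    (e : (EuclideanSpace ℝ (Fin 2) × F) ≃L[ℝ] EuclideanSpace ℝ (Fin 3)) :
    FiniteDimensional ℝ F ∧ Module.finrank ℝ F = 1 := by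
  have h1 : FiniteDimensional ℝ (EuclideanSpace ℝ (Fin 2) × F) :=
    Module.Finite.equiv e.symm.toLinearEquiv
  have h2 : FiniteDimensional ℝ F :=
    Module.Finite.of_surjective (LinearMap.snd ℝ (EuclideanSpace ℝ (Fin 2)) F)
      LinearMap.snd_surjective
  refine ⟨h2, ?_⟩
  have h3 := e.toLinearEquiv.finrank_eq
  rw [Module.finrank_prod] at h3
  simp at h3
  omega

/-- The normal form of an immersion gives coordinates in which j is u ↦ (u, 0). Because j is a
topological embedding, the neighbourhood can be shrunk until it contains no other sheet of the
image. -/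
lemma exists_isSliceChart {j : T → M} (hj : Manifold.IsSmoothEmbedding (𝓡 2) (𝓡 3) ∞ j)
    {X : ∀ x : M, TangentSpace (𝓡 3) x} {p : T}
    (hX : X (j p) ∉ range (mfderiv (𝓡 2) (𝓡 3) j p)) :
    ∃ κ σ U W, IsSliceChart j p κ σ U W ∧ lieDeriv X (fun x => (κ x).2) (j p) ≠ 0 := by
  obtain ⟨F, _, _, hF⟩ := hj.isImmersion
  obtain ⟨hFd, hF1⟩ := finrank_complement (hF p).equiv
  -- The complement in the normal form is one-dimensional, hence may be taken to be ℝ.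
  have h : Manifold.IsImmersionAtOfComplement ℝ (𝓡 2) (𝓡 3) ∞ j p :=
    (hF p).trans_F (ContinuousLinearEquiv.ofFinrankEq (by simp [hF1]))
  set d := h.domChart with hd
  set c := h.codChart with hc
  set e := h.equiv with he
  have hde : ∀ u ∈ d.target, c (j (d.symm u)) = e (u, 0) := by
    intro u hu
    exact h.writtenInCharts (by simpa using hu)
  have hpd : p ∈ d.source := h.mem_domChart_source
  obtain ⟨U₁, hU₁, hU₁d⟩ := hj.isEmbedding.isOpen_iff.1 d.open_source
  have hjc : ∀ s ∈ d.source, j s ∈ c.source := h.source_subset_preimage_source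
  have hcs : ContMDiffOn (𝓡 3) (𝓡 3) ∞ c c.source :=
    contMDiffOn_of_mem_maximalAtlas h.codChart_mem_maximalAtlas
  have hct : ContMDiffOn (𝓡 3) (𝓡 3) ∞ c.symm c.target :=
    contMDiffOn_symm_of_mem_maximalAtlas h.codChart_mem_maximalAtlas
  have hdt : ContMDiffOn (𝓡 2) (𝓡 2) ∞ d.symm d.target :=
    contMDiffOn_symm_of_mem_maximalAtlas h.domChart_mem_maximalAtlas
  set Ω : Set (EuclideanSpace ℝ (Fin 2) × ℝ) :=
    {w | w.1 ∈ d.target} ∩ e ⁻¹' (c.target ∩ c.symm ⁻¹' U₁) with hΩ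
  have hΩo : IsOpen Ω := (d.open_target.preimage continuous_fst).inter
    ((c.isOpen_inter_preimage_symm hU₁).preimage e.continuous)
  have hκj : ∀ s ∈ d.source, e.symm (c (j s)) = (d s, 0) := by
    intro s hs
    have := hde (d s) (d.map_source hs)
    rw [d.left_inv hs] at this
    rw [this, e.symm_apply_apply]
  have hw₀ : (d p, (0 : ℝ)) ∈ Ω := by
    refine ⟨d.map_source hpd, ?_⟩
    have := hde (d p) (d.map_source hpd)
    rw [d.left_inv hpd] at this
    rw [mem_preimage, ← this]
    refine ⟨c.map_source (hjc p hpd), ?_⟩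
    rw [mem_preimage, c.left_inv (hjc p hpd)]
    rw [← hU₁d] at hpd
    exact hpd
  obtain ⟨r, hr, hrΩ⟩ := Metric.isOpen_iff.1 hΩo _ hw₀
  -- A ball for the maximum metric is a product, so projecting a point of it to the slice does not
  -- leave it.
  set W := Metric.ball (d p, (0 : ℝ)) r with hW
  set κ : M → EuclideanSpace ℝ (Fin 2) × ℝ := fun x => e.symm (c x) with hκ
  set σ : EuclideanSpace ℝ (Fin 2) × ℝ → M := fun w => c.symm (e w) with hσ
  have hκc : ContMDiffOn (𝓡 3) 𝓘(ℝ, EuclideanSpace ℝ (Fin 2) × ℝ) ∞ κ c.source :=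
    e.symm.contDiff.contMDiff.comp_contMDiffOn hcs
  have hUo : IsOpen ((c.source ∩ κ ⁻¹' W) ∩ U₁) :=
    (hκc.continuousOn.isOpen_inter_preimage c.open_source Metric.isOpen_ball).inter hU₁
  have hσW : ContMDiffOn 𝓘(ℝ, EuclideanSpace ℝ (Fin 2) × ℝ) (𝓡 3) ∞ σ W :=
    hct.comp e.contDiff.contMDiff.contMDiffOn fun w hw => (hrΩ hw).2.1
  have hslice : ∀ w ∈ W, (w.1, (0 : ℝ)) ∈ W := by
    intro w hw
    rw [hW, Metric.mem_ball, Prod.dist_eq] at hw ⊢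
    simp only [dist_self]
    exact max_lt (lt_of_le_of_lt (le_max_left _ _) hw) hr
  have hrange : ∀ w ∈ W, w.2 = 0 → σ w = j (d.symm w.1) := by
    intro w hw hw0
    have h1 : w.1 ∈ d.target := (hrΩ hw).1
    have h2 := hde w.1 h1
    have h3 : w = (w.1, 0) := Prod.ext rfl hw0
    rw [hσ]
    simp only
    rw [h3, ← h2, c.left_inv (hjc _ (d.map_target h1))]
  have hjU : j p ∈ (c.source ∩ κ ⁻¹' W) ∩ U₁ := by
    refine ⟨⟨hjc p hpd, ?_⟩, ?_⟩
    · rw [mem_preimage, hκ]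
      simp only
      rw [hκj p hpd]
      exact Metric.mem_ball_self hr
    · rw [← hU₁d] at hpd; exact hpd
  have hchart : IsSliceChart j p κ σ ((c.source ∩ κ ⁻¹' W) ∩ U₁) W :=
    { isOpen_source := hUo
      isOpen_target := Metric.isOpen_ball
      mem_source := hjU
      mapsTo := fun x hx => hx.1.2
      left_inv := fun x hx => by
        rw [hσ, hκ]
        simp only
        rw [e.apply_symm_apply, c.left_inv hx.1.1]
      smooth := hκc.mono fun x hx => hx.1.1
      smooth_symm := hσW
      snd_eq_zero := by
        rintro x hx ⟨s, rfl⟩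
        have hs : s ∈ d.source := by rw [← hU₁d]; exact hx.2
        rw [hκ]
        simp only
        rw [hκj s hs]
      mem_range := fun w hw hw0 => by
        rw [hrange w hw hw0]; exact mem_range_self _
      slice_mem := hslice }
  -- If the transverse coordinate had zero derivative along X, then X would be the image under dσ of
  -- a vector in the slice. There σ agrees with j in coordinates, so X would lie in the range of the
  -- differential of j.
  refine ⟨κ, σ, _, W, hchart, fun h0 => hX ?_⟩
  have hκp : κ (j p) = (d p, 0) := hκj p hpd
  have hκd : MDifferentiableAt (𝓡 3) 𝓘(ℝ, EuclideanSpace ℝ (Fin 2) × ℝ) κ (j p) :=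
    (hκc.contMDiffAt (c.open_source.mem_nhds (hjc p hpd))).mdifferentiableAt (by simp)
  have hσd : MDifferentiableAt 𝓘(ℝ, EuclideanSpace ℝ (Fin 2) × ℝ) (𝓡 3) σ (d p, 0) :=
    (hσW.contMDiffAt (Metric.ball_mem_nhds _ hr)).mdifferentiableAt (by simp)
  set Y : EuclideanSpace ℝ (Fin 2) × ℝ :=
    mfderiv (𝓡 3) 𝓘(ℝ, EuclideanSpace ℝ (Fin 2) × ℝ) κ (j p) (X (j p)) with hY
  have hY0 : Y.2 = 0 := by
    have h1 := (((ContinuousLinearMap.snd ℝ (EuclideanSpace ℝ (Fin 2)) ℝ).hasMFDerivAt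
      (x := κ (j p))).comp (j p) hκd.hasMFDerivAt).mfderiv
    rw [← h0]
    exact (DFunLike.congr_fun h1 (X (j p))).symm
  rw [← hκp] at hσd
  have hXY : mfderiv 𝓘(ℝ, EuclideanSpace ℝ (Fin 2) × ℝ) (𝓡 3) σ (κ (j p)) Y = X (j p) := by
    have h1 := (hσd.hasMFDerivAt.comp (j p) hκd.hasMFDerivAt).mfderiv
    have h2 : σ ∘ κ =ᶠ[𝓝 (j p)] id := by
      filter_upwards [hUo.mem_nhds hjU] with x hx
      exact hchart.left_inv x hx
    rw [h2.mfderiv_eq, mfderiv_id] at h1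
    exact (DFunLike.congr_fun h1 (X (j p))).symm
  have hdd : MDifferentiableAt (𝓡 2) (𝓡 2) d.symm (d p) :=
    (hdt.contMDiffAt (d.open_target.mem_nhds (d.map_source hpd))).mdifferentiableAt (by simp)
  have hjd : MDifferentiableAt (𝓡 2) (𝓡 3) j (d.symm (d p)) :=
    hj.contMDiff.mdifferentiableAt (by simp)
  set l := ContinuousLinearMap.inl ℝ (EuclideanSpace ℝ (Fin 2)) ℝ with hl
  have hκl : κ (j p) = l (d p) := hκp
  rw [hκl] at hσd hXY
  have h3 := (hσd.hasMFDerivAt.comp (d p) (l.hasMFDerivAt (x := d p))).mfderiv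
  have h4 := (hjd.hasMFDerivAt.comp (d p) hdd.hasMFDerivAt).mfderiv
  have h5 : σ ∘ l =ᶠ[𝓝 (d p)] j ∘ d.symm := by
    have hn : l ⁻¹' W ∈ 𝓝 (d p) :=
      l.continuous.continuousAt.preimage_mem_nhds (Metric.ball_mem_nhds _ hr)
    filter_upwards [hn] with u hu
    exact hrange _ hu rfl
  have h6 := (h3.symm.trans h5.mfderiv_eq).trans h4
  have hYl : Y = l Y.1 := Prod.ext rfl hY0
  have hdp : d.symm (d p) = p := d.left_inv hpd
  have h7 := DFunLike.congr_fun h6 Y.1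
  have h8 : X (j p) = mfderiv (𝓡 2) (𝓡 3) j (d.symm (d p))
      (mfderiv (𝓡 2) (𝓡 2) d.symm (d p) Y.1) := by
    rw [← hXY, hYl]
    exact h7
  rw [hdp] at h8
  exact ⟨_, h8.symm⟩

end Slice

/-! ### Derivatives along the vector field. -/

section LieDeriv

variable {M : Type*} [TopologicalSpace M] [ChartedSpace (EuclideanSpace ℝ (Fin 3)) M]
  {X : ∀ x : M, TangentSpace (𝓡 3) x}

lemma lieDeriv_congr {f g : M → ℝ} {x : M} (h : f =ᶠ[𝓝 x] g) : lieDeriv X f x = lieDeriv X g x := by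
  exact DFunLike.congr_fun (h.mfderiv_eq (I := 𝓡 3) (I' := 𝓘(ℝ, ℝ))) (X x)

lemma lieDeriv_const (c : ℝ) (x : M) : lieDeriv X (fun _ => c) x = 0 := by
  have h := mfderiv_const (I := 𝓡 3) (I' := 𝓘(ℝ, ℝ)) (M := M) (c := c) (x := x)
  exact DFunLike.congr_fun h (X x)

lemma lieDeriv_mul {f g : M → ℝ} {x : M} (hf : MDifferentiableAt (𝓡 3) 𝓘(ℝ, ℝ) f x)
    (hg : MDifferentiableAt (𝓡 3) 𝓘(ℝ, ℝ) g x) :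
    lieDeriv X (fun y => f y * g y) x = f x * lieDeriv X g x + g x * lieDeriv X f x :=
  DFunLike.congr_fun (hf.hasMFDerivAt.mul hg.hasMFDerivAt).mfderiv (X x)

lemma lieDeriv_add {f g : M → ℝ} {x : M} (hf : MDifferentiableAt (𝓡 3) 𝓘(ℝ, ℝ) f x)
    (hg : MDifferentiableAt (𝓡 3) 𝓘(ℝ, ℝ) g x) :
    lieDeriv X (fun y => f y + g y) x = lieDeriv X f x + lieDeriv X g x :=
  DFunLike.congr_fun (hf.hasMFDerivAt.add hg.hasMFDerivAt).mfderiv (X x)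

lemma mdifferentiableAt_sum {ι : Type*} (t : Finset ι) {f : ι → M → ℝ} {x : M}
    (hf : ∀ i, MDifferentiableAt (𝓡 3) 𝓘(ℝ, ℝ) (f i) x) :
    MDifferentiableAt (𝓡 3) 𝓘(ℝ, ℝ) (fun y => ∑ i ∈ t, f i y) x := by
  classical
  induction t using Finset.induction_on with
  | empty => simpa using mdifferentiableAt_const
  | insert i s hi IH =>
    simp only [Finset.sum_insert hi]
    exact (hf i).add IH

lemma lieDeriv_sum {ι : Type*} (t : Finset ι) {f : ι → M → ℝ} {x : M}
    (hf : ∀ i, MDifferentiableAt (𝓡 3) 𝓘(ℝ, ℝ) (f i) x) :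
    lieDeriv X (fun y => ∑ i ∈ t, f i y) x = ∑ i ∈ t, lieDeriv X (f i) x := by
  classical
  induction t using Finset.induction_on with
  | empty => simpa using lieDeriv_const 0 x
  | insert i s hi IH =>
    simp only [Finset.sum_insert hi]
    rw [lieDeriv_add (hf i) (mdifferentiableAt_sum s hf), IH]

variable [IsManifold (𝓡 3) ∞ M]

/-- The derivative is the fibre component of the tangent map of f composed with the section X, and
both are continuous. -/
lemma continuousOn_lieDeriv
    (hX : ContMDiff (𝓡 3) (𝓡 3).tangent ∞ (fun x => (⟨x, X x⟩ : TangentBundle (𝓡 3) M)))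
    {f : M → ℝ} {U : Set M} (hU : IsOpen U) (hf : ContMDiffOn (𝓡 3) 𝓘(ℝ, ℝ) ∞ f U) :
    ContinuousOn (lieDeriv X f) U := by
  have h1 := hf.continuousOn_tangentMapWithin (by simp) hU.uniqueMDiffOn
  have h2 : ContinuousOn (fun x => tangentMapWithin (𝓡 3) 𝓘(ℝ, ℝ) f U ⟨x, X x⟩) U :=
    h1.comp hX.continuous.continuousOn fun x hx => hx
  have h3 := (tangentBundleModelSpaceHomeomorph 𝓘(ℝ, ℝ)).continuous.comp_continuousOn h2
  refine (continuous_snd.comp_continuousOn h3).congr fun x hx => ?_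
  rw [lieDeriv, ← mfderivWithin_of_isOpen hU hx]
  rfl

end LieDeriv

section Slice

variable {M : Type*} [TopologicalSpace M] [ChartedSpace (EuclideanSpace ℝ (Fin 3)) M]
  {T : Type*}
  {X : ∀ x : M, TangentSpace (𝓡 3) x} {j : T → M} {p : T}
  {κ : M → EuclideanSpace ℝ (Fin 2) × ℝ} {σ : EuclideanSpace ℝ (Fin 2) × ℝ → M} {U : Set M}
  {W : Set (EuclideanSpace ℝ (Fin 2) × ℝ)}

/-- A function that vanishes on a slice and has nonzero transverse derivative vanishes only on the
slice, locally. -/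
lemma IsSliceChart.eventually_mem_range (hc : IsSliceChart j p κ σ U W) {b : M → ℝ}
    (hb : ContMDiff (𝓡 3) 𝓘(ℝ, ℝ) ∞ b) (hb0 : ∀ x ∈ range j, b x = 0)
    (hXb : lieDeriv X b (j p) ≠ 0) : ∀ᶠ x in 𝓝 (j p), b x = 0 → x ∈ range j := by
  have hU := hc.isOpen_source.mem_nhds hc.mem_source
  set w₀ := κ (j p) with hw₀
  have hw₀W : w₀ ∈ W := hc.mapsTo hc.mem_source
  have hw₀2 : w₀.2 = 0 := hc.snd_eq_zero _ hc.mem_source (mem_range_self p)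
  have hβ : ContDiffAt ℝ ∞ (b ∘ σ) w₀ :=
    ((hb.comp_contMDiffOn hc.smooth_symm).contMDiffAt
      (hc.isOpen_target.mem_nhds hw₀W)).contDiffAt
  obtain ⟨D, hD⟩ : ∃ D, HasStrictFDerivAt (b ∘ σ) D w₀ := ⟨_, hβ.hasStrictFDerivAt (by simp)⟩
  have hκd : MDifferentiableAt (𝓡 3) 𝓘(ℝ, EuclideanSpace ℝ (Fin 2) × ℝ) κ (j p) :=
    (hc.smooth.contMDiffAt hU).mdifferentiableAt (by simp)
  set Y : EuclideanSpace ℝ (Fin 2) × ℝ :=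
    mfderiv (𝓡 3) 𝓘(ℝ, EuclideanSpace ℝ (Fin 2) × ℝ) κ (j p) (X (j p)) with hY
  have hXY : lieDeriv X b (j p) = D Y := by
    have h1 := (hD.hasFDerivAt.hasMFDerivAt.comp (j p) hκd.hasMFDerivAt).mfderiv
    have h2 : b =ᶠ[𝓝 (j p)] (b ∘ σ) ∘ κ := by
      filter_upwards [hU] with x hx
      simp only [Function.comp_apply, hc.left_inv x hx]
    rw [lieDeriv_congr h2]
    exact DFunLike.congr_fun h1 (X (j p))
  have hD0 : ∀ u, D (u, 0) = 0 := by
    intro u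
    set l := ContinuousLinearMap.inl ℝ (EuclideanSpace ℝ (Fin 2)) ℝ with hl
    have hl0 : l w₀.1 = w₀ := Prod.ext rfl hw₀2.symm
    have h1 : HasFDerivAt ((b ∘ σ) ∘ l) (D.comp l) w₀.1 :=
      HasFDerivAt.comp w₀.1 (by rw [hl0]; exact hD.hasFDerivAt) l.hasFDerivAt
    have h2 : (b ∘ σ) ∘ l =ᶠ[𝓝 w₀.1] fun _ => 0 := by
      have hn : l ⁻¹' W ∈ 𝓝 w₀.1 :=
        l.continuous.continuousAt.preimage_mem_nhds
          (hc.isOpen_target.mem_nhds (by rw [hl0]; exact hw₀W))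
      filter_upwards [hn] with v hv
      exact hb0 _ (hc.mem_range _ hv rfl)
    have h3 := (h1.congr_of_eventuallyEq h2.symm).unique (hasFDerivAt_const (0 : ℝ) w₀.1)
    exact DFunLike.congr_fun h3 u
  set m := D (0, 1) with hm
  have hDt : ∀ u t, D (u, t) = t * m := by
    intro u t
    have h1 : (u, t) = (u, (0 : ℝ)) + t • ((0 : EuclideanSpace ℝ (Fin 2)), (1 : ℝ)) := by
      ext <;> simp
    rw [h1, map_add, hD0, map_smul, zero_add, smul_eq_mul]
  have hm0 : m ≠ 0 := by
    intro h
    refine hXb ?_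
    rw [hXY, show Y = (Y.1, Y.2) from rfl, hDt, h, mul_zero]
  -- Strict differentiability compares a zero x of b with its projection to the slice, where b also
  -- vanishes. At height t = (κ x).2 this reads |t m| ≤ |m| |t| / 2, which forces t = 0.
  have hlit := hD.isLittleO.def (half_pos (abs_pos.2 hm0))
  have htend : Filter.Tendsto (fun x => (κ x, ((κ x).1, (0 : ℝ)))) (𝓝 (j p)) (𝓝 (w₀, w₀)) := by
    have hκc : ContinuousAt κ (j p) := hκd.continuousAt
    have h1 : ((κ (j p)).1, (0 : ℝ)) = w₀ := Prod.ext rfl hw₀2.symm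
    have h2 : ContinuousAt (fun x => (κ x, ((κ x).1, (0 : ℝ)))) (j p) :=
      hκc.prodMk ((continuous_fst.continuousAt.comp hκc).prodMk continuousAt_const)
    have h3 := h2.tendsto
    simp only [h1] at h3
    exact h3
  filter_upwards [htend.eventually hlit, hU] with x hx hxU hbx
  have hxW := hc.mapsTo hxU
  have h1 : b (σ ((κ x).1, 0)) = 0 := hb0 _ (hc.mem_range _ (hc.slice_mem _ hxW) rfl)
  have h2 : κ x - ((κ x).1, (0 : ℝ)) = (0, (κ x).2) := by ext <;> simp
  simp only [Function.comp_apply] at hx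
  rw [h1, hc.left_inv x hxU, hbx, h2, hDt, sub_zero, zero_sub, norm_neg, norm_mul,
    Prod.norm_mk, norm_zero, max_eq_right (norm_nonneg _), Real.norm_eq_abs, Real.norm_eq_abs] at hx
  have h3 : (κ x).2 = 0 := by
    have := abs_pos.2 hm0
    have h4 : |(κ x).2| * |m| ≤ 0 := by nlinarith [abs_nonneg (κ x).2]
    by_contra hne
    have := abs_pos.2 hne
    nlinarith
  rw [← hc.left_inv x hxU]
  exact hc.mem_range _ hxW h3

end Slice

/-! ### The closed one-form dual to a cross-section. -/

section DefiningFunction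

variable {M : Type*} [TopologicalSpace M] [ChartedSpace (EuclideanSpace ℝ (Fin 3)) M]
  [IsManifold (𝓡 3) ∞ M]
  {T : Type*} [TopologicalSpace T] [ChartedSpace (EuclideanSpace ℝ (Fin 2)) T]
  {X : ∀ x : M, TangentSpace (𝓡 3) x} {j : T → M}

/-- Near a point of a cross-section, there is a smooth function that vanishes on the cross-section
and increases along the vector field. -/
lemma exists_local_defining_function
    (hX : ContMDiff (𝓡 3) (𝓡 3).tangent ∞ (fun x => (⟨x, X x⟩ : TangentBundle (𝓡 3) M)))
    (hj : Manifold.IsSmoothEmbedding (𝓡 2) (𝓡 3) ∞ j) {p : T}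
    (hXj : X (j p) ∉ range (mfderiv (𝓡 2) (𝓡 3) j p)) :
    ∃ (g : M → ℝ) (U : Set M), IsOpen U ∧ j p ∈ U ∧ ContMDiffOn (𝓡 3) 𝓘(ℝ, ℝ) ∞ g U ∧
      (∀ x ∈ U, x ∈ range j → g x = 0) ∧ ∀ x ∈ U, 0 < lieDeriv X g x := by
  obtain ⟨κ, σ, U, W, hc, hne⟩ := exists_isSliceChart hj hXj
  set c := lieDeriv X (fun x => (κ x).2) (j p) with hcdef
  have hκ2 : ContMDiffOn (𝓡 3) 𝓘(ℝ, ℝ) ∞ (fun x => (κ x).2) U :=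
    (ContinuousLinearMap.snd ℝ (EuclideanSpace ℝ (Fin 2)) ℝ).contMDiff.comp_contMDiffOn hc.smooth
  have hg : ContMDiffOn (𝓡 3) 𝓘(ℝ, ℝ) ∞ (fun x => c * (κ x).2) U :=
    contMDiffOn_const.mul hκ2
  -- The factor c makes the derivative along X at `j p` equal to c² > 0, whatever the sign of c; by
  -- continuity it stays positive nearby.
  have hcont := continuousOn_lieDeriv hX hc.isOpen_source hg
  have hpos : 0 < lieDeriv X (fun x => c * (κ x).2) (j p) := by
    rw [lieDeriv_mul mdifferentiableAt_const ((hκ2.contMDiffAt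
      (hc.isOpen_source.mem_nhds hc.mem_source)).mdifferentiableAt (by simp)), lieDeriv_const,
      mul_zero, add_zero]
    exact mul_self_pos.2 hne
  refine ⟨fun x => c * (κ x).2, U ∩ lieDeriv X (fun x => c * (κ x).2) ⁻¹' Ioi 0,
    hcont.isOpen_inter_preimage hc.isOpen_source isOpen_Ioi, ⟨hc.mem_source, hpos⟩,
    hg.mono inter_subset_left, fun x hx hxj => ?_, fun x hx => hx.2⟩
  simp only
  rw [hc.snd_eq_zero x hx.1 hxj, mul_zero]

variable [T2Space M] [CompactSpace M]

/-- A compact cross-section is the zero set of a smooth function that increases along the vector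
field, in a neighbourhood of the cross-section. -/
lemma exists_defining_function [CompactSpace T]
    (hX : ContMDiff (𝓡 3) (𝓡 3).tangent ∞ (fun x => (⟨x, X x⟩ : TangentBundle (𝓡 3) M)))
    (hj : Manifold.IsSmoothEmbedding (𝓡 2) (𝓡 3) ∞ j)
    (hXj : ∀ p, X (j p) ∉ range (mfderiv (𝓡 2) (𝓡 3) j p)) :
    ∃ b : M → ℝ, ContMDiff (𝓡 3) 𝓘(ℝ, ℝ) ∞ b ∧ (∀ x ∈ range j, b x = 0) ∧
      (∀ x ∈ range j, 0 < lieDeriv X b x) ∧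
      ∀ x ∈ range j, ∀ᶠ y in 𝓝 x, b y = 0 → y ∈ range j := by
  choose g U hU hpU hg hg0 hgX using fun p => exists_local_defining_function hX hj (hXj p)
  have hjc : Continuous j := hj.isEmbedding.continuous
  have hTc : IsCompact (range j) := isCompact_range hjc
  obtain ⟨F, hF⟩ := hTc.elim_finite_subcover U hU (by
    rintro _ ⟨p, rfl⟩
    exact mem_iUnion.2 ⟨p, hpU p⟩)
  obtain ⟨ρ, hρ⟩ := SmoothPartitionOfUnity.exists_isSubordinate (𝓡 3) hTc.isClosed
    (fun i : F => U i) (fun i => hU i) (fun x hx => by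
      obtain ⟨p, hp, hxp⟩ := mem_iUnion₂.1 (hF hx)
      exact mem_iUnion.2 ⟨⟨p, hp⟩, hxp⟩)
  have hs : ∀ i, ContMDiff (𝓡 3) 𝓘(ℝ, ℝ) ∞ (fun x => ρ i x * g i x) := fun i =>
    ρ.contMDiff_smul fun x hx => (hg i).contMDiffAt ((hU i).mem_nhds (hρ i hx))
  have hb : ContMDiff (𝓡 3) 𝓘(ℝ, ℝ) ∞ (fun x => ∑ i, ρ i x * g i x) :=
    contMDiff_finsetSum fun i _ => hs i
  have hb0 : ∀ x ∈ range j, ∑ i, ρ i x * g i x = 0 := by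
    intro x hx
    refine Finset.sum_eq_zero fun i _ => ?_
    by_cases hxi : x ∈ tsupport (ρ i)
    · rw [hg0 i x (hρ i hxi) hx, mul_zero]
    · rw [image_eq_zero_of_notMem_tsupport hxi, zero_mul]
  -- The local functions vanish on the cross-section, so the derivatives of the partition of unity
  -- do not contribute there.
  have hterm : ∀ x ∈ range j, ∀ i,
      lieDeriv X (fun x => ρ i x * g i x) x = ρ i x * lieDeriv X (g i) x := by
    intro x hx i
    by_cases hxi : x ∈ tsupport (ρ i)
    · rw [lieDeriv_mul ((ρ i).contMDiff.mdifferentiableAt (by simp))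
        (((hg i).contMDiffAt ((hU i).mem_nhds (hρ i hxi))).mdifferentiableAt (by simp)),
        hg0 i x (hρ i hxi) hx, zero_mul, add_zero]
    · have h1 : (fun x => ρ i x * g i x) =ᶠ[𝓝 x] fun _ => 0 := by
        filter_upwards [(isClosed_tsupport (ρ i)).isOpen_compl.mem_nhds hxi] with y hy
        rw [image_eq_zero_of_notMem_tsupport hy, zero_mul]
      rw [lieDeriv_congr h1, lieDeriv_const, image_eq_zero_of_notMem_tsupport hxi, zero_mul]
  have hbX : ∀ x ∈ range j, 0 < lieDeriv X (fun x => ∑ i, ρ i x * g i x) x := by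
    intro x hx
    rw [lieDeriv_sum _ fun i => (hs i).mdifferentiableAt (by simp)]
    simp only [hterm x hx]
    have hnn : ∀ i, ρ i x ≠ 0 → 0 < ρ i x * lieDeriv X (g i) x := fun i hi =>
      mul_pos (lt_of_le_of_ne (ρ.nonneg i x) hi.symm) (hgX i x (hρ i (subset_tsupport _ hi)))
    obtain ⟨i, hi⟩ := ρ.exists_pos_of_mem hx
    refine Finset.sum_pos' (fun i _ => ?_) ⟨i, Finset.mem_univ i, hnn i hi.ne'⟩
    by_cases h0 : ρ i x = 0
    · rw [h0, zero_mul]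
    · exact (hnn i h0).le
  refine ⟨_, hb, hb0, hbX, ?_⟩
  rintro _ ⟨p, rfl⟩
  obtain ⟨κ, σ, U, W, hc, -⟩ := exists_isSliceChart hj (hXj p)
  exact hc.eventually_mem_range hb hb0 (hbX _ (mem_range_self p)).ne'

/-- The closed one-form `a db` dual to a compact cross-section. -/
lemma exists_dual_form [CompactSpace T]
    (hX : ContMDiff (𝓡 3) (𝓡 3).tangent ∞ (fun x => (⟨x, X x⟩ : TangentBundle (𝓡 3) M)))
    (hj : Manifold.IsSmoothEmbedding (𝓡 2) (𝓡 3) ∞ j)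
    (hXj : ∀ p, X (j p) ∉ range (mfderiv (𝓡 2) (𝓡 3) j p)) :
    ∃ a b : M → ℝ, ContMDiff (𝓡 3) 𝓘(ℝ, ℝ) ∞ a ∧ ContMDiff (𝓡 3) 𝓘(ℝ, ℝ) ∞ b ∧
      (∀ x, 0 ≤ a x) ∧ (∀ x ∈ range j, 0 < a x) ∧ (∀ x, a x ≠ 0 → 0 < lieDeriv X b x) ∧
      ∀ x, ∃ φ : ℝ → ℝ, Differentiable ℝ φ ∧ a =ᶠ[𝓝 x] φ ∘ b := by
  obtain ⟨b, hb, hb0, hbX, hbj⟩ := exists_defining_function hX hj hXj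
  have hTc : IsCompact (range j) := isCompact_range hj.isEmbedding.continuous
  have hcont : Continuous (lieDeriv X b) := by
    rw [← continuousOn_univ]
    exact continuousOn_lieDeriv hX isOpen_univ hb.contMDiffOn
  have hloc : LocallyCompactSpace M := ChartedSpace.locallyCompactSpace (EuclideanSpace ℝ (Fin 3)) M
  set O : Set M := interior {x | 0 < lieDeriv X b x ∧ (b x = 0 → x ∈ range j)} with hO
  have hTO : range j ⊆ O := by
    intro x hx
    rw [hO, mem_interior_iff_mem_nhds]
    filter_upwards [hcont.continuousAt.eventually (lt_mem_nhds (hbX x hx)), hbj x hx] with y h1 h2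
    exact ⟨h1, h2⟩
  obtain ⟨K, hK, hTK, hKO⟩ := exists_compact_between hTc isOpen_interior hTO
  -- On the compact set K \ interior K the function b has no zero, since in O its zeros lie in
  -- `range j`, which is inside the interior of K.
  obtain ⟨ε, hε, hεK⟩ : ∃ ε > 0, ∀ x ∈ K \ interior K, ε ≤ |b x| := by
    have hcomp : IsCompact (K \ interior K) := hK.diff isOpen_interior
    rcases (K \ interior K).eq_empty_or_nonempty with he | hne
    · exact ⟨1, one_pos, by simp [he]⟩
    · obtain ⟨x, hx, hmin⟩ := hcomp.exists_isMinOn hne (hb.continuous.abs.continuousOn)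
      refine ⟨|b x|, abs_pos.2 fun h => hx.2 (hTK ?_), fun y hy => hmin hy⟩
      exact (interior_subset (hKO hx.1)).2 h
  let f : ContDiffBump (0 : ℝ) := ⟨ε / 4, ε / 2, by positivity, by linarith⟩
  have hf0 : ∀ t : ℝ, ε / 2 ≤ |t| → f t = 0 := fun t ht =>
    f.zero_of_le_dist (by simpa using ht)
  classical
  -- The cutoff at K is smooth: the bump f vanishes from ε/2 on, and |b| ≥ ε on K \ interior K.
  set a : M → ℝ := fun x => if x ∈ K then f (b x) else 0 with ha
  have hlocal : ∀ x, ∃ φ : ℝ → ℝ, ContDiff ℝ ∞ φ ∧ a =ᶠ[𝓝 x] φ ∘ b := by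
    intro x
    by_cases hxi : x ∈ interior K
    · refine ⟨f, f.contDiff, ?_⟩
      filter_upwards [isOpen_interior.mem_nhds hxi] with y hy
      exact if_pos (interior_subset hy)
    refine ⟨fun _ => 0, contDiff_const, ?_⟩
    by_cases hxK : x ∈ K
    · have h1 : ε / 2 < |b x| := by
        have := hεK x ⟨hxK, hxi⟩
        linarith
      filter_upwards [hb.continuous.abs.continuousAt.eventually (lt_mem_nhds h1)] with y hy
      simp only [ha, Function.comp_apply, hf0 _ hy.le, ite_self]
    · filter_upwards [hK.isClosed.isOpen_compl.mem_nhds hxK] with y hy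
      exact if_neg hy
  refine ⟨a, b, fun x => ?_, hb, fun x => ?_, fun x hx => ?_, fun x hx => ?_, fun x => ?_⟩
  · obtain ⟨φ, hφ, he⟩ := hlocal x
    exact ((hφ.contMDiff.comp hb).contMDiffAt).congr_of_eventuallyEq he
  · simp only [ha]
    split_ifs
    · exact f.nonneg
    · exact le_rfl
  · simp only [ha, if_pos (interior_subset (hTK hx)), hb0 x hx]
    exact f.pos_of_mem_ball (by simpa using f.rOut_pos)
  · have hxK : x ∈ K := by
      by_contra h
      exact hx (if_neg h)
    exact (interior_subset (hKO hxK)).1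
  · obtain ⟨φ, hφ, he⟩ := hlocal x
    exact ⟨φ, hφ.differentiable (by simp), he⟩

end DefiningFunction

/-! ### Completeness of vector fields on compact manifolds. -/

section Complete

variable {E : Type*} [NormedAddCommGroup E] [NormedSpace ℝ E]
  {H : Type*} [TopologicalSpace H] {I : ModelWithCorners ℝ E H}
  {M : Type*} [TopologicalSpace M] [ChartedSpace H M] [IsManifold I 1 M]
  {v : (x : M) → TangentSpace I x}

/-- A curve that solves the differential equation in a chart is an integral curve. -/
lemma hasMFDerivAt_extChartAt_symm_comp {x₀ : M} {f : ℝ → E} {t : ℝ}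
    (ht : f t ∈ interior (extChartAt I x₀).target)
    (h : HasDerivAt f (tangentCoordChange I ((extChartAt I x₀).symm (f t)) x₀
      ((extChartAt I x₀).symm (f t)) (v ((extChartAt I x₀).symm (f t)))) t) :
    HasMFDerivAt 𝓘(ℝ, ℝ) I ((extChartAt I x₀).symm ∘ f) t
      ((1 : ℝ →L[ℝ] ℝ).smulRight (v (((extChartAt I x₀).symm ∘ f) t))) := by
  let xₜ : M := (extChartAt I x₀).symm (f t)
  have ht' := interior_subset ht
  have hft1 := (extChartAt I x₀).target_subset_preimage_source ht'
  have hft2 := mem_extChartAt_source (I := I) xₜ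
  let w : E := v xₜ
  suffices hd : HasDerivAt ((extChartAt I xₜ ∘ (extChartAt I x₀).symm) ∘ f) w t from
    ⟨(continuousAt_extChartAt_symm'' ht').comp h.continuousAt, hd.hasFDerivAt.hasFDerivWithinAt⟩
  rw [← tangentCoordChange_self (I := I) (x := xₜ) (z := xₜ) (v := w) hft2,
    ← tangentCoordChange_comp (x := x₀) ⟨⟨hft2, hft1⟩, hft2⟩]
  apply HasFDerivAt.comp_hasDerivAt _ _ h
  apply HasFDerivWithinAt.hasFDerivAt (s := range I) _ <|
    mem_nhds_iff.mpr ⟨interior (extChartAt I x₀).target,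
      subset_trans interior_subset (extChartAt_target_subset_range ..),
      isOpen_interior, ht⟩
  rw [← (extChartAt I x₀).right_inv ht']
  exact hasFDerivWithinAt_tangentCoordChange ⟨hft1, hft2⟩

variable [CompleteSpace E] [BoundarylessManifold I M]

/-- The integral curves starting near a given point exist for a uniform time. -/
lemma exists_eventually_isMIntegralCurveOn
    (hv : ContMDiff I I.tangent 1 (fun x => (⟨x, v x⟩ : TangentBundle I M))) (x₀ : M) :
    ∃ ε > 0, ∀ᶠ x in 𝓝 x₀, ∃ γ : ℝ → M, γ 0 = x ∧ IsMIntegralCurveOn γ v (Ioo (-ε) ε) := by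
  have hx : I.IsInteriorPoint x₀ := BoundarylessManifold.isInteriorPoint
  have hv₀ := hv x₀
  rw [contMDiffAt_iff] at hv₀
  -- The time ε serves all initial values in a ball, and the local flow α is jointly continuous; so
  -- for a common short time all nearby solutions stay inside the chart.
  obtain ⟨ε, hε, a, r, L, K, hr, hpl⟩ := IsPicardLindelof.of_contDiffAt_one
    (hv₀.2.contDiffAt (range_mem_nhds_isInteriorPoint hx)).snd
  obtain ⟨α, hα, hαc⟩ :=
    (hpl 0).exists_forall_mem_closedBall_eq_hasDerivWithinAt_continuousOn
  set y₀ := extChartAt I x₀ x₀ with hy₀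
  have hα0 : α (y₀, 0) = y₀ := (hα y₀ (Metric.mem_closedBall_self r.2)).1
  have hcont : ContinuousAt α (y₀, 0) := by
    refine hαc.continuousAt (prod_mem_nhds (Metric.closedBall_mem_nhds _ hr)
      (Icc_mem_nhds ?_ ?_)) <;> linarith
  have hev : ∀ᶠ p in 𝓝 (y₀, (0 : ℝ)), α p ∈ interior (extChartAt I x₀).target := by
    refine hcont.eventually_mem ?_
    rw [hα0]
    exact isOpen_interior.mem_nhds (I.isInteriorPoint_iff.mp hx)
  rw [nhds_prod_eq, Filter.eventually_prod_iff] at hev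
  obtain ⟨P, hP, Q, hQ, hPQ⟩ := hev
  obtain ⟨δ, hδ, hδQ⟩ := Metric.eventually_nhds_iff_ball.1 hQ
  refine ⟨min ε δ, lt_min hε hδ, ?_⟩
  have hc := (continuousAt_extChartAt (I := I) x₀).eventually
    (hP.and (Metric.closedBall_mem_nhds y₀ hr))
  filter_upwards [hc, extChartAt_source_mem_nhds (I := I) x₀] with x hxP hxs
  obtain ⟨h0, hd⟩ := hα _ hxP.2
  refine ⟨(extChartAt I x₀).symm ∘ fun t => α (extChartAt I x₀ x, t), ?_, fun t ht => ?_⟩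
  · rw [Function.comp_apply, h0, (extChartAt I x₀).left_inv hxs]
  have htε : t ∈ Ioo (0 - ε) (0 + ε) := by
    rw [zero_sub, zero_add]
    exact ⟨(neg_le_neg (min_le_left _ _)).trans_lt ht.1, ht.2.trans_le (min_le_left _ _)⟩
  have htδ : t ∈ Metric.ball (0 : ℝ) δ := by
    rw [Real.ball_eq_Ioo, zero_sub, zero_add]
    exact ⟨(neg_le_neg (min_le_right _ _)).trans_lt ht.1, ht.2.trans_le (min_le_right _ _)⟩
  exact (hasMFDerivAt_extChartAt_symm_comp (hPQ hxP.1 (hδQ t htδ))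
    ((hd t (Ioo_subset_Icc_self htε)).hasDerivAt
      (Icc_mem_nhds htε.1 htε.2))).hasMFDerivWithinAt

/-- On a compact manifold without boundary, there is an integral curve through every point. -/
lemma exists_isMIntegralCurve [T2Space M] [CompactSpace M]
    (hv : ContMDiff I I.tangent 1 (fun x => (⟨x, v x⟩ : TangentBundle I M))) (x : M) :
    ∃ γ : ℝ → M, γ 0 = x ∧ IsMIntegralCurve γ v := by
  choose ε hε hev using exists_eventually_isMIntegralCurveOn hv
  obtain ⟨F, hF⟩ := isCompact_univ.elim_nhds_subcover _ fun y _ => hev y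
  have hne : F.Nonempty := by
    obtain ⟨y, hy, -⟩ := mem_iUnion₂.1 (hF.2 (mem_univ x))
    exact ⟨y, hy⟩
  refine exists_isMIntegralCurve_of_isMIntegralCurveOn hv (ε := F.inf' hne ε)
    ((Finset.lt_inf'_iff hne).2 fun y _ => hε y) (fun y => ?_) x
  obtain ⟨y', hy', γ, hγ, hγ'⟩ := mem_iUnion₂.1 (hF.2 (mem_univ y))
  have hle := Finset.inf'_le ε hy'
  exact ⟨γ, hγ, hγ'.mono (Ioo_subset_Ioo (neg_le_neg hle) hle)⟩

end Complete

/-! ### Invariance of the boundary image under the flow. -/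

section Charts

variable {E : Type*} [NormedAddCommGroup E] [NormedSpace ℝ E]
  {H : Type*} [TopologicalSpace H] {I : ModelWithCorners ℝ E H}
  {M : Type*} [TopologicalSpace M] [ChartedSpace H M] [IsManifold I 1 M]
  {E' : Type*} [NormedAddCommGroup E'] [NormedSpace ℝ E']
  {H' : Type*} [TopologicalSpace H'] {I' : ModelWithCorners ℝ E' H'}
  {M' : Type*} [TopologicalSpace M'] [ChartedSpace H' M'] [IsManifold I' 1 M']

/-- The differential of a map, expressed in arbitrary charts. -/
lemma hasFDerivWithinAt_inCharts {f : M → M'} {p x : M} {q : M'}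
    (hf : MDifferentiableAt I I' f x) (hp : x ∈ (extChartAt I p).source)
    (hq : f x ∈ (extChartAt I' q).source) :
    HasFDerivWithinAt (extChartAt I' q ∘ f ∘ (extChartAt I p).symm)
      ((tangentCoordChange I' (f x) q (f x)).comp
        ((show E →L[ℝ] E' from mfderiv I I' f x).comp (tangentCoordChange I p x x)))
      (range I) (extChartAt I p x) := by
  have h1 := hasFDerivWithinAt_tangentCoordChange (I := I) (x := p) (y := x)
    ⟨hp, mem_extChartAt_source x⟩
  have h2 : HasFDerivWithinAt (extChartAt I' (f x) ∘ f ∘ (extChartAt I x).symm)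
      (show E →L[ℝ] E' from mfderiv I I' f x) (range I) (extChartAt I x x) := hf.hasMFDerivAt.2
  have h3 := hasFDerivWithinAt_tangentCoordChange (I := I') (x := f x) (y := q)
    ⟨mem_extChartAt_source (f x), hq⟩
  have e1 : (extChartAt I x ∘ (extChartAt I p).symm) (extChartAt I p x) = extChartAt I x x := by
    rw [Function.comp_apply, (extChartAt I p).left_inv hp]
  have e2 : (extChartAt I' (f x) ∘ f ∘ (extChartAt I x).symm) (extChartAt I x x) =
      extChartAt I' (f x) (f x) := by
    rw [Function.comp_apply, Function.comp_apply, (extChartAt I x).left_inv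
      (mem_extChartAt_source x)]
  rw [← e1] at h2 e2
  rw [← e2] at h3
  have h4 := HasFDerivWithinAt.comp _ h3 h2 (fun y _ => mem_range_self _)
  have h5 := HasFDerivWithinAt.comp _ h4 h1 (fun y _ => mem_range_self _)
  have hc : ContinuousAt (extChartAt I p).symm (extChartAt I p x) :=
    continuousAt_extChartAt_symm' hp
  have hx : (extChartAt I p).symm (extChartAt I p x) = x := (extChartAt I p).left_inv hp
  have hev : ∀ᶠ y in 𝓝 (extChartAt I p x), (extChartAt I p).symm y ∈ (extChartAt I x).source ∧
      f ((extChartAt I p).symm y) ∈ (extChartAt I' (f x)).source := by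
    refine hc.eventually (p := fun y => y ∈ (extChartAt I x).source ∧ f y ∈
      (extChartAt I' (f x)).source) ?_
    rw [hx]
    exact Filter.inter_mem (extChartAt_source_mem_nhds x)
      (hf.continuousAt (extChartAt_source_mem_nhds (f x)))
  refine h5.congr_of_eventuallyEq ?_ ?_
  · filter_upwards [nhdsWithin_le_nhds hev] with y hy
    simp only [Function.comp_apply]
    rw [(extChartAt I x).left_inv hy.1, (extChartAt I' (f x)).left_inv hy.2]
  · simp only [Function.comp_apply]
    rw [hx, (extChartAt I x).left_inv (mem_extChartAt_source x),
      (extChartAt I' (f x)).left_inv (mem_extChartAt_source (f x))]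

end Charts

section BoundaryCurve

/-- The boundary line of the half-plane. -/
noncomputable def boundaryLine (s : ℝ) : Plane := planeEquiv (0, s)

lemma boundaryLine_mem (s : ℝ) : boundaryLine s ∈ halfPlane := mem_halfPlane.2 le_rfl

lemma contDiff_boundaryLine : ContDiff ℝ ∞ boundaryLine :=
  planeEquiv.contDiff.comp (contDiff_const.prodMk contDiff_id)

lemma hasDerivAt_boundaryLine (s : ℝ) :
    HasDerivAt boundaryLine (EuclideanSpace.single 1 1) s := by
  have h : HasDerivAt (fun s : ℝ => ((0 : ℝ), s)) (0, 1) s :=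
    (hasDerivAt_const s 0).prodMk (hasDerivAt_id s)
  have := planeEquiv.hasFDerivAt.comp_hasDerivAt s h
  rw [ContinuousLinearEquiv.coe_coe, planeEquiv_snd] at this
  exact this

/-- A curve everywhere proportional to a vector field can be reparametrized as a solution of the
corresponding differential equation. -/
lemma exists_reparametrization {F : Type*} [NormedAddCommGroup F] [InnerProductSpace ℝ F]
    {C : ℝ → F} {V : F → F} {s₀ : ℝ} (hC : ContDiffAt ℝ ∞ C s₀) (hV : ContDiffAt ℝ 1 V (C s₀))
    (hV0 : V (C s₀) ≠ 0) (hCV : ∀ᶠ s in 𝓝 s₀, ∃ c : ℝ, V (C s) = c • deriv C s) (t₀ : ℝ) :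
    ∃ σ : ℝ → ℝ, σ t₀ = s₀ ∧ ContinuousAt σ t₀ ∧
      ∀ᶠ t in 𝓝 t₀, HasDerivAt (C ∘ σ) (V (C (σ t))) t := by
  have hC' : ContDiffAt ℝ 1 (deriv C) s₀ :=
    (hC.fderiv_right (m := 1) (WithTop.coe_le_coe.2 (le_top : (1 + 1 : ℕ∞) ≤ ⊤))).clm_apply contDiffAt_const
  have hne : deriv C s₀ ≠ 0 := by
    obtain ⟨c, hc⟩ := hCV.self_of_nhds
    intro h
    rw [h, smul_zero] at hc
    exact hV0 hc
  -- f is the C¹ coefficient with V ∘ C = f C', obtained by orthogonal projection. A solution of σ'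
  -- = f(σ) then satisfies (C ∘ σ)' = V(C ∘ σ).
  let f : ℝ → ℝ := fun s => inner ℝ (V (C s)) (deriv C s) / inner ℝ (deriv C s) (deriv C s)
  have hf : ContDiffAt ℝ 1 f s₀ :=
    ((hV.comp s₀ (hC.of_le (by simp))).inner ℝ hC').div (hC'.inner ℝ hC') (inner_self_ne_zero.2 hne)
  obtain ⟨σ, hσ0, ε, hε, hσ⟩ :=
    hf.exists_forall_mem_closedBall_exists_eq_forall_mem_Ioo_hasDerivAt₀ t₀
  have hI : Ioo (t₀ - ε) (t₀ + ε) ∈ 𝓝 t₀ := Ioo_mem_nhds (by linarith) (by linarith)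
  have hσc : ContinuousAt σ t₀ := (hσ t₀ (mem_of_mem_nhds hI)).continuousAt
  refine ⟨σ, hσ0, hσc, ?_⟩
  have hdiff : ∀ᶠ s in 𝓝 s₀, DifferentiableAt ℝ C s := by
    filter_upwards [(hC.of_le (m := 1) (by simp)).eventually (by simp)] with s hs
    exact hs.differentiableAt (by simp)
  have hall := hCV.and (hdiff.and (hC'.continuousAt.eventually_ne hne))
  rw [← hσ0] at hall
  filter_upwards [hσc.eventually hall, hI] with t ⟨⟨c, hc⟩, hd, h0⟩ ht
  have h1 : f (σ t) = c := by
    simp only [f]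
    rw [hc, inner_smul_left, mul_div_assoc, div_self (inner_self_ne_zero.2 h0)]
    simp
  have h2 := hd.hasDerivAt.scomp t (hσ t ht)
  rwa [h1, ← hc] at h2

variable {M : Type*} [TopologicalSpace M] [ChartedSpace (EuclideanSpace ℝ (Fin 3)) M]
  [IsManifold (𝓡 3) ∞ M]
  {S : Type*} [TopologicalSpace S] [ChartedSpace (EuclideanHalfSpace 2) S]
  [IsManifold (𝓡∂ 2) ∞ S] {X : ∀ x : M, TangentSpace (𝓡 3) x} {ι : S → M}

lemma boundaryLine_source {z : S} {s : ℝ}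
    (hs : boundaryLine s ∈ (extChartAt (𝓡∂ 2) z).target) :
    (extChartAt (𝓡∂ 2) z).symm (boundaryLine s) ∈ (𝓡∂ 2).boundary S := by
  rw [boundary_iff_zero ((extChartAt (𝓡∂ 2) z).map_target hs),
    (extChartAt (𝓡∂ 2) z).right_inv hs]
  rfl

/-- If a vector field is tangent to the image of the boundary of a surface, then its integral
curves remain locally in the image of the boundary. -/
lemma exists_boundary_isMIntegralCurveAt
    (hX : ContMDiff (𝓡 3) (𝓡 3).tangent ∞ (fun x => (⟨x, X x⟩ : TangentBundle (𝓡 3) M)))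
    (hι : ContMDiff (𝓡∂ 2) (𝓡 3) ∞ ι)
    (htan : ∀ z ∈ (𝓡∂ 2).boundary S, ∃ a : TangentSpace (𝓡∂ 2) z, inwardCoord a = 0 ∧
      mfderiv (𝓡∂ 2) (𝓡 3) ι z a = X (ι z))
    {z : S} (hz : z ∈ (𝓡∂ 2).boundary S) (hX0 : X (ι z) ≠ 0) (t₀ : ℝ) :
    ∃ η : ℝ → M, η t₀ = ι z ∧ IsMIntegralCurveAt η X t₀ ∧
      ∀ᶠ t in 𝓝 t₀, η t ∈ ι '' (𝓡∂ 2).boundary S := by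
  set e := extChartAt (𝓡∂ 2) z with he
  set F := extChartAt (𝓡 3) (ι z) with hF
  set s₀ : ℝ := e z 1 with hs₀
  have hzs : z ∈ e.source := mem_extChartAt_source z
  have hline : boundaryLine s₀ = e z := by
    have h0 : e z 0 = 0 := (boundary_iff_zero hzs).1 hz
    ext i; fin_cases i
    · exact h0.symm
    · rfl
  have hsymm : e.symm (boundaryLine s₀) = z := by rw [hline, e.left_inv hzs]
  let D : ℝ → S := fun s => e.symm (boundaryLine s)
  have htarget : ∀ᶠ s in 𝓝 s₀, boundaryLine s ∈ e.target := by
    have h1 : Filter.Tendsto boundaryLine (𝓝 s₀) (𝓝[halfPlane] (e z)) := by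
      rw [← hline]
      exact tendsto_nhdsWithin_iff.2 ⟨contDiff_boundaryLine.continuous.continuousAt,
        Filter.Eventually.of_forall boundaryLine_mem⟩
    exact h1.eventually (extChartAt_target_mem_nhdsWithin z)
  have hD : ContMDiffAt 𝓘(ℝ, ℝ) (𝓡∂ 2) ∞ D s₀ := by
    have h1 : ContMDiffWithinAt 𝓘(ℝ, Plane) (𝓡∂ 2) ∞ e.symm e.target (boundaryLine s₀) :=
      contMDiffOn_extChartAt_symm z _ (by rw [hline]; exact e.map_source hzs)
    exact (h1.comp s₀ (contDiff_boundaryLine.contMDiff.contMDiffAt (x := s₀)).contMDiffWithinAt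
      (s := boundaryLine ⁻¹' e.target) fun s hs => hs).contMDiffAt htarget
  let C : ℝ → EuclideanSpace ℝ (Fin 3) := fun s => F (ι (D s))
  have hC : ContDiffAt ℝ ∞ C s₀ := by
    rw [← contMDiffAt_iff_contDiffAt]
    refine ContMDiffAt.comp s₀ (g := F) ?_ (hι.contMDiffAt.comp s₀ hD)
    refine contMDiffAt_extChartAt' ?_
    simp only [D]
    rw [hsymm]
    exact mem_chart_source _ _
  have hX' : ContMDiffAt (𝓡 3) (𝓡 3).tangent 1
      (fun x => (⟨x, X x⟩ : TangentBundle (𝓡 3) M)) (ι z) := (hX (ι z)).of_le (by simp)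
  have hCs₀ : C s₀ = F (ι z) := by simp only [C, D]; rw [hsymm]
  -- V is X in the chart at `ι z`, and C is the boundary curve in that chart; tangency makes V a
  -- multiple of C' along C.
  let V : EuclideanSpace ℝ (Fin 3) → EuclideanSpace ℝ (Fin 3) := fun x =>
    tangentCoordChange (𝓡 3) (F.symm x) (ι z) (F.symm x) (X (F.symm x))
  have hV : ContDiffAt ℝ 1 V (C s₀) := by
    rw [hCs₀]
    rw [contMDiffAt_iff] at hX'
    exact (hX'.2.contDiffAt (range_mem_nhds_isInteriorPoint
      BoundarylessManifold.isInteriorPoint)).snd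
  have hFs : ι z ∈ F.source := mem_extChartAt_source _
  have hVF : ∀ x ∈ F.source, V (F x) = tangentCoordChange (𝓡 3) x (ι z) x (X x) := fun x hx =>
    congrArg (fun y => (show EuclideanSpace ℝ (Fin 3) from
      tangentCoordChange (𝓡 3) y (ι z) y (X y))) (F.left_inv hx)
  have hV0 : V (C s₀) ≠ 0 := by
    intro h
    rw [hCs₀, hVF _ hFs] at h
    exact hX0 ((tangentCoordChange_self hFs).symm.trans h)
  have hsource : ∀ᶠ s in 𝓝 s₀, ι (D s) ∈ F.source := by
    have h1 : ContinuousAt (fun s => ι (D s)) s₀ :=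
      hι.continuous.continuousAt.comp hD.continuousAt
    refine h1.eventually_mem ?_
    simp only [D]
    rw [hsymm]
    exact extChartAt_source_mem_nhds _
  have hCV : ∀ᶠ s in 𝓝 s₀, ∃ c : ℝ, V (C s) = c • deriv C s := by
    filter_upwards [htarget, hsource] with s hs hs'
    have hx : D s ∈ e.source := e.map_target hs
    have hxb : D s ∈ (𝓡∂ 2).boundary S := boundaryLine_source hs
    have hex : e (D s) = boundaryLine s := e.right_inv hs
    obtain ⟨a, ha, haX⟩ := htan _ hxb
    have h1 := hasFDerivWithinAt_inCharts (f := ι) (I := 𝓡∂ 2) (I' := 𝓡 3)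
      (hι.mdifferentiableAt (by simp)) hx hs'
    rw [← he, hex] at h1
    have h2 := h1.comp_hasDerivAt_of_eq s (hasDerivAt_boundaryLine s)
      (Filter.Eventually.of_forall fun t => boundaryLine_mem t) rfl
    set u : Plane := tangentCoordChange (𝓡∂ 2) (D s) z (D s) a with hu
    have hu0 : u 0 = 0 := tangentCoordChange_zero (mem_extChartAt_source _) hx hxb ha
    have hu1 : u = u 1 • EuclideanSpace.single 1 1 := by
      conv_lhs => rw [plane_eq u, hu0, zero_smul, zero_add]
    refine ⟨u 1, ?_⟩
    have h3 : deriv C s = _ := h2.deriv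
    rw [h3, ← map_smul, ← hu1]
    exact (hVF _ hs').trans (congrArg (tangentCoordChange (𝓡 3) (ι (D s)) (ι z) (ι (D s)))
      (haX.symm.trans (congrArg (mfderiv (𝓡∂ 2) (𝓡 3) ι (D s))
        (tangentCoordChange_cancel (mem_extChartAt_source _) hx a).symm)))
  obtain ⟨σ, hσ0, hσc, hσ⟩ := exists_reparametrization hC hV hV0 hCV t₀
  rw [← hσ0] at htarget hsource hCs₀
  have hcont : ContinuousAt (C ∘ σ) t₀ := hσ.self_of_nhds.continuousAt
  have hint : ∀ᶠ t in 𝓝 t₀, (C ∘ σ) t ∈ interior F.target := by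
    refine hcont.eventually_mem ?_
    rw [Function.comp_apply, hCs₀]
    exact isOpen_interior.mem_nhds
      ((𝓡 3).isInteriorPoint_iff.1 BoundarylessManifold.isInteriorPoint)
  refine ⟨F.symm ∘ (C ∘ σ), ?_, ?_, ?_⟩
  · rw [Function.comp_apply, Function.comp_apply, hCs₀, F.left_inv hFs]
  · filter_upwards [hσ, hint] with t ht ht'
    exact hasMFDerivAt_extChartAt_symm_comp ht' ht
  · filter_upwards [hσc.eventually htarget, hσc.eventually hsource] with t ht ht'
    exact ⟨D (σ t), boundaryLine_source ht, (F.left_inv ht').symm⟩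

end BoundaryCurve

section Orbits

variable {M : Type*} [TopologicalSpace M] [ChartedSpace (EuclideanSpace ℝ (Fin 3)) M]
  [IsManifold (𝓡 3) ∞ M] [T2Space M]
  {S : Type*} [TopologicalSpace S] [ChartedSpace (EuclideanHalfSpace 2) S]
  [IsManifold (𝓡∂ 2) ∞ S] [CompactSpace S] {X : ∀ x : M, TangentSpace (𝓡 3) x} {ι : S → M}

/-- If a vector field is tangent to the image of the boundary of a compact surface, then this image
is invariant under the flow. -/
lemma isMIntegralCurve_mem_image_boundary
    (hX : ContMDiff (𝓡 3) (𝓡 3).tangent ∞ (fun x => (⟨x, X x⟩ : TangentBundle (𝓡 3) M)))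
    (hX0 : ∀ x, X x ≠ 0) (hι : ContMDiff (𝓡∂ 2) (𝓡 3) ∞ ι)
    (htan : ∀ z ∈ (𝓡∂ 2).boundary S, ∃ a : TangentSpace (𝓡∂ 2) z, inwardCoord a = 0 ∧
      mfderiv (𝓡∂ 2) (𝓡 3) ι z a = X (ι z))
    {γ : ℝ → M} (hγ : IsMIntegralCurve γ X) {t₀ : ℝ}
    (h₀ : γ t₀ ∈ ι '' (𝓡∂ 2).boundary S) (t : ℝ) : γ t ∈ ι '' (𝓡∂ 2).boundary S := by
  have hcont : Continuous γ := continuous_iff_continuousAt.2 fun s =>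
    (hγ.isMIntegralCurveAt s).continuousAt
  -- The times spent in the boundary image form a closed set by compactness, and an open one by
  -- local solutions inside the image and uniqueness of integral curves; ℝ is connected.
  have hclosed : IsClosed (γ ⁻¹' (ι '' (𝓡∂ 2).boundary S)) :=
    (((𝓡∂ 2).isClosed_boundary (n := ∞) (by simp)).isCompact.image
      hι.continuous).isClosed.preimage hcont
  have hopen : IsOpen (γ ⁻¹' (ι '' (𝓡∂ 2).boundary S)) := by
    refine isOpen_iff_mem_nhds.2 fun s hs => ?_
    obtain ⟨z, hz, hzs⟩ := hs
    obtain ⟨η, hη, hηX, hηS⟩ := exists_boundary_isMIntegralCurveAt hX hι htan hz (hX0 _) s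
    have heq : γ =ᶠ[𝓝 s] η := isMIntegralCurveAt_eventuallyEq_of_contMDiffAt_boundaryless
      ((hX _).of_le (by simp)) (hγ.isMIntegralCurveAt s) hηX (hzs.symm.trans hη.symm)
    filter_upwards [heq, hηS] with r h1 h2
    rw [mem_preimage, h1]
    exact h2
  have huniv := IsClopen.eq_univ ⟨hclosed, hopen⟩ ⟨t₀, h₀⟩
  exact huniv.ge (mem_univ t)

end Orbits

/-! ### Pulling the dual form back to the surface. -/

section Differential

variable {M : Type*} [TopologicalSpace M] [ChartedSpace (EuclideanSpace ℝ (Fin 3)) M]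
  {S : Type*} [TopologicalSpace S] [ChartedSpace (EuclideanHalfSpace 2) S]
  {X : ∀ x : M, TangentSpace (𝓡 3) x} {ι : S → M}

lemma differential_comp {f : M → ℝ} (hf : ContMDiff (𝓡 3) 𝓘(ℝ, ℝ) ∞ f)
    (hι : ContMDiff (𝓡∂ 2) (𝓡 3) ∞ ι) (z : S) (w : TangentSpace (𝓡∂ 2) z) :
    differential (f ∘ ι) z w =
      (show ℝ from mfderiv (𝓡 3) 𝓘(ℝ, ℝ) f (ι z) (mfderiv (𝓡∂ 2) (𝓡 3) ι z w)) :=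
  DFunLike.congr_fun (mfderiv_comp z (hf.mdifferentiableAt (by simp))
    (hι.mdifferentiableAt (by simp))) w

lemma differential_smul (f : S → ℝ) (z : S) (c : ℝ) (w : TangentSpace (𝓡∂ 2) z) :
    differential f z (c • w) = c * differential f z w :=
  (mfderiv (𝓡∂ 2) 𝓘(ℝ, ℝ) f z).map_smul c w

lemma differential_const_smul {f : S → ℝ} {z : S} (hf : MDifferentiableAt (𝓡∂ 2) 𝓘(ℝ, ℝ) f z)
    (c : ℝ) (w : TangentSpace (𝓡∂ 2) z) :
    differential (fun x => c * f x) z w = c * differential f z w :=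
  DFunLike.congr_fun (const_smul_mfderiv hf c) w

/-- The differential of a function of `b` is proportional to the differential of `b`. -/
lemma differential_eq_of_eventuallyEq {A B : S → ℝ} {z : S} {φ : ℝ → ℝ}
    (hB : MDifferentiableAt (𝓡∂ 2) 𝓘(ℝ, ℝ) B z) (hφ : Differentiable ℝ φ)
    (h : A =ᶠ[𝓝 z] φ ∘ B) (w : TangentSpace (𝓡∂ 2) z) :
    differential A z w = deriv φ (B z) * differential B z w := by
  have h1 : HasMFDerivAt 𝓘(ℝ, ℝ) 𝓘(ℝ, ℝ) φ (B z) (fderiv ℝ φ (B z)) :=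
    (hφ (B z)).hasFDerivAt.hasMFDerivAt
  have h2 := ((h1.comp z hB.hasMFDerivAt).congr_of_eventuallyEq h).mfderiv
  refine (DFunLike.congr_fun h2 w).trans ?_
  exact (fderiv_eq_smul_deriv (f := φ) (differential B z w)).trans (mul_comm _ _)

end Differential

/-- If `ν, w` and `ν, w'` are positive frames of a plane and `w = c w'`, then `c` is positive. -/
lemma IsPositiveFrame.pos_of_smul {V : Type*} [AddCommGroup V] [Module ℝ V]
    {o : Orientation ℝ V (Fin 2)} {ν w : V} {c : ℝ} (h : IsPositiveFrame o ![ν, w])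
    (hc : IsPositiveFrame o ![ν, c • w]) : 0 < c := by
  obtain ⟨b, hb, rfl⟩ := h
  obtain ⟨b', hb', ho⟩ := hc
  rw [eq_comm, Module.Basis.orientation_eq_iff_det_pos, hb', Module.Basis.det_apply,
    Matrix.det_fin_two] at ho
  have h0 : ν = b 0 := by rw [hb]; rfl
  have h1 : w = b 1 := by rw [hb]; rfl
  simpa [Module.Basis.toMatrix_apply, h0, h1] using ho

/-- Two tangent vectors to the boundary of a surface are proportional. -/
lemma exists_eq_smul_of_inwardCoord {S : Type*} [TopologicalSpace S]
    [ChartedSpace (EuclideanHalfSpace 2) S] {z : S} {a w : TangentSpace (𝓡∂ 2) z}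
    (ha : inwardCoord a = 0) (ha0 : a ≠ 0) (hw : inwardCoord w = 0) : ∃ c : ℝ, w = c • a := by
  obtain ⟨u, hu⟩ : ∃ u : Plane, u = a := ⟨a, rfl⟩
  obtain ⟨v, hv⟩ : ∃ v : Plane, v = w := ⟨w, rfl⟩
  have hu0 : u 0 = 0 := by rw [hu]; exact ha
  have hv0 : v 0 = 0 := by rw [hv]; exact hw
  have hu1 : u 1 ≠ 0 := by
    intro h
    refine ha0 (hu.symm.trans ?_)
    change u = 0
    rw [plane_eq u, hu0, h, zero_smul, zero_smul, add_zero]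
  have hvu : v = (v 1 / u 1) • u := by
    ext i; fin_cases i
    · simp [hu0, hv0]
    · simp [div_mul_cancel₀ _ hu1]
  exact ⟨v 1 / u 1, hv.symm.trans (hvu.trans (congrArg (fun x => (v 1 / u 1) • x) hu))⟩

/-! ### The contradiction between Stokes' theorem and the invariant boundary. -/

section Main

variable {M : Type*} [TopologicalSpace M] [ChartedSpace (EuclideanSpace ℝ (Fin 3)) M]
  [IsManifold (𝓡 3) ∞ M] [T2Space M] [CompactSpace M]
  {S : Type*} [TopologicalSpace S] [ChartedSpace (EuclideanHalfSpace 2) S]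
  [IsManifold (𝓡∂ 2) ∞ S] [CompactSpace S]
  {X : ∀ x : M, TangentSpace (𝓡 3) x} {ι : S → M}
  {T : Type*} [TopologicalSpace T] [ChartedSpace (EuclideanSpace ℝ (Fin 2)) T] {j : T → M}

/-- Some boundary point of a partial section lies on a given cross-section. -/
lemma IsPartialSection.exists_boundary_mem_range (hι : IsPartialSection X ι)
    (hX : ContMDiff (𝓡 3) (𝓡 3).tangent ∞ (fun x => (⟨x, X x⟩ : TangentBundle (𝓡 3) M)))
    (hX0 : ∀ x, X x ≠ 0) (hj : IsGlobalCrossSection X j) :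
    ∃ z ∈ (𝓡∂ 2).boundary S, ι z ∈ range j := by
  obtain ⟨z₀, hz₀⟩ := hι.boundary_nonempty
  obtain ⟨γ, hγ0, hγ⟩ := exists_isMIntegralCurve (hX.of_le (by simp)) (ι z₀)
  obtain ⟨t, ht⟩ := hj.meets_orbits γ hγ
  obtain ⟨z, hz, hzt⟩ := isMIntegralCurve_mem_image_boundary hX hX0 hι.immersion.contMDiff
    hι.tangent_boundary hγ (t₀ := 0) (hγ0 ▸ mem_image_of_mem ι hz₀) t
  exact ⟨z, hz, hzt ▸ ht⟩

/-- A vector field with a global cross-section has no partial section whose boundary orientation is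
everywhere the direction of the vector field, or everywhere opposite to it. -/
lemma IsPartialSection.not_isGlobalCrossSection [T2Space S] [CompactSpace T]
    (hι : IsPartialSection X ι)
    (hX : ContMDiff (𝓡 3) (𝓡 3).tangent ∞ (fun x => (⟨x, X x⟩ : TangentBundle (𝓡 3) M)))
    (hX0 : ∀ x, X x ≠ 0) (oS : ManifoldOrientation (𝓡∂ 2) S) {s : ℝ} (hs : s ≠ 0)
    (hsign : ∀ z ∈ (𝓡∂ 2).boundary S, ∀ ν a : TangentSpace (𝓡∂ 2) z,
      inwardCoord ν < 0 → inwardCoord a = 0 → mfderiv (𝓡∂ 2) (𝓡 3) ι z a = X (ι z) →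
        IsPositiveFrame (oS.at' z) ![ν, s • a]) : ¬ IsGlobalCrossSection X j := by
  intro hj
  obtain ⟨a, b, ha, hb, ha0, haj, hab, hφ⟩ := exists_dual_form hX hj.embedding hj.transverse
  have hιs : ContMDiff (𝓡∂ 2) (𝓡 3) ∞ ι := hι.immersion.contMDiff
  have hbι : ContMDiff (𝓡∂ 2) 𝓘(ℝ, ℝ) ∞ (b ∘ ι) := hb.comp hιs
  have hA : ContMDiff (𝓡∂ 2) 𝓘(ℝ, ℝ) ∞ (a ∘ ι) := ha.comp hιs
  -- The factor s makes the form nonnegative on the oriented boundary whether the boundary follows X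
  -- or opposes it.
  have hB : ContMDiff (𝓡∂ 2) 𝓘(ℝ, ℝ) ∞ (fun x => s * (b ∘ ι) x) := contMDiff_const.mul hbι
  have hdB : ∀ z (w : TangentSpace (𝓡∂ 2) z),
      differential (fun x => s * (b ∘ ι) x) z w = s * differential (b ∘ ι) z w := fun z w =>
    differential_const_smul (hbι.mdifferentiableAt (by simp)) s w
  have hAB : ∀ z (v w : TangentSpace (𝓡∂ 2) z),
      differential (a ∘ ι) z v * differential (fun x => s * (b ∘ ι) x) z w =
        differential (a ∘ ι) z w * differential (fun x => s * (b ∘ ι) x) z v := by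
    intro z v w
    obtain ⟨φ, hφd, hφe⟩ := hφ (ι z)
    have he : a ∘ ι =ᶠ[𝓝 z] φ ∘ (b ∘ ι) :=
      hφe.comp_tendsto hιs.continuous.continuousAt
    have hd := differential_eq_of_eventuallyEq (hbι.mdifferentiableAt (by simp)) hφd he
    rw [hdB, hdB, hd, hd]
    ring
  have hX' : ∀ z (u : TangentSpace (𝓡∂ 2) z), mfderiv (𝓡∂ 2) (𝓡 3) ι z u = X (ι z) →
      differential (b ∘ ι) z u = lieDeriv X b (ι z) := fun z u hu =>
    (differential_comp hb hιs z u).trans (congrArg (mfderiv (𝓡 3) 𝓘(ℝ, ℝ) b (ι z)) hu)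
  have hbd : ∀ z ∈ (𝓡∂ 2).boundary S, ∀ ν w : TangentSpace (𝓡∂ 2) z,
      inwardCoord ν < 0 → inwardCoord w = 0 → IsPositiveFrame (oS.at' z) ![ν, w] →
        0 ≤ (a ∘ ι) z * differential (fun x => s * (b ∘ ι) x) z w := by
    intro z hz ν w hν hw hframe
    obtain ⟨u, hu, huX⟩ := hι.tangent_boundary z hz
    have hu0 : u ≠ 0 := by
      intro h
      exact hX0 (ι z) (huX.symm.trans ((congrArg _ h).trans (map_zero _)))
    obtain ⟨c, rfl⟩ := exists_eq_smul_of_inwardCoord hu hu0 hw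
    -- Both s u and w = c u complete ν to a positive frame, so c / s > 0, and the factor s c in the
    -- form equals s² (c / s).
    have hc : c • u = (c / s) • s • u := by rw [smul_smul, div_mul_cancel₀ c hs]
    rw [hc] at hframe
    have hpos := (hsign z hz ν u hν hu huX).pos_of_smul hframe
    rw [hdB, differential_smul, hX' z u huX]
    by_cases h0 : a (ι z) = 0
    · rw [Function.comp_apply, h0, zero_mul]
    have h1 : s * (c * lieDeriv X b (ι z)) = s * s * (c / s) * lieDeriv X b (ι z) := by
      field_simp
    rw [h1]
    exact mul_nonneg (ha0 _) (mul_pos (mul_pos (mul_self_pos.2 hs) hpos) (hab _ h0)).le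
  obtain ⟨z, hz, hzj⟩ := hι.exists_boundary_mem_range hX hX0 hj
  obtain ⟨u, hu, huX⟩ := hι.tangent_boundary z hz
  have h := boundary_form_eq_zero oS hA hB hAB hbd hz hu
  rw [hdB, hX' z u huX] at h
  have hpos := haj _ hzj
  exact mul_ne_zero hpos.ne' (mul_ne_zero hs (hab _ hpos.ne').ne') h

end Main

end PartialSections

theorem mainTheorem11
    (M : Type u) [TopologicalSpace M] [T2Space M] [CompactSpace M]
    [ChartedSpace (EuclideanSpace ℝ (Fin 3)) M] [IsManifold (𝓡 3) ∞ M]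
    (oM : PartialSections.ManifoldOrientation (𝓡 3) M)
    (X : ∀ x : M, TangentSpace (𝓡 3) x)
    (hX : ContMDiff (𝓡 3) (𝓡 3).tangent ∞ (fun x => (⟨x, X x⟩ : TangentBundle (𝓡 3) M)))
    (hX0 : ∀ x, X x ≠ 0)
    (hpartial : PartialSections.AdmitsSignedPartialSection.{u, v} X oM) :
    ¬ PartialSections.AdmitsGlobalCrossSection.{u, w} X := by
  rintro ⟨T, _, _, _, _, _, j, hj⟩
  obtain ⟨S, _, _, _, _, _, ι, ⟨hι, oS, -, hS⟩ | ⟨hι, oS, -, hS⟩⟩ := hpartial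
  · refine hι.not_isGlobalCrossSection hX hX0 oS one_ne_zero (fun z hz ν a hν ha haX => ?_) hj
    rw [one_smul]
    exact hS z hz ν a hν ha haX
  · refine hι.not_isGlobalCrossSection hX hX0 oS (neg_ne_zero.2 one_ne_zero)
      (fun z hz ν a hν ha haX => ?_) hj
    rw [neg_one_smul]
    exact hS z hz ν a hν ha haX
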